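/- Let $n\ge 1$, let $e_1,\dots,e_n$ be a basis of $\mathbb R^n$, and let $Y=\{\sum_i x_ie_i:\ 0<x_i<1\}$ be the open unit cell of the lattice it spans. For $F,G\in\mathbb R^{n\times n}$ write $F\cdot G=\sum_{p,i}F_{pi}G_{pi}$. Let $\mathbb L$ be the set of symmetric linear maps $L:\mathbb R^{n\times n}\to\mathbb R^{n\times n}$ that are either positive definite on $\mathbb R^{n\times n}$ or elasticity tensors (that is, $LF=LF^{T}$ and $LF$ is symmetric for all $F$, and $F\cdot LF>0$ for every symmetric $F\neq0$). Let $L_1\in\mathbb L$, and let $L_0\in\mathbb L$ have components $$(L_0)_{piqj}=\mu_1\delta_{ij}\delta_{pq}+\mu_2\delta_{pj}\delta_{iq}+\lambda\delta_{ip}\delta_{jq}\qquad(\mu_1,\mu_2,\lambda\in\mathbb R).$$ Let $Q$ be a symmetric positive semidefinite $n\times n$ matrix with $\operatorname{Tr}Q=1$. Let $\Omega\subset Y$ be a measurable set with volume fraction $\theta=|\Omega|/|Y|\in(0,1)$ which is (the part in $Y$ of) a periodic E-inclusion for $Q$: there is $u\in W^{2,2}_{per}(Y)$ with $$\Delta u=\theta-\chi_\Omega\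 \text{ a.e. on }Y,\qquad \nabla\nabla u=-(1-\theta)Q\ \text{ a.e. on }\Omega.$$ Put $L(x,\Omega)=L_1$ for $x\in\Omega$ and $L(x,\Omega)=L_0$ for $x\in Y\setminus\Omega$. The effective tensor $L^e(\Omega)$ is the symmetric tensor with $$\tfrac12F\cdot L^e(\Omega)F=\min_{v\in W^{1,2}_{per}(Y;\mathbb R^n)}\frac1{2|Y|}\int_Y(\nabla v+F)\cdot L(x,\Omega)(\nabla v+F)\,dx\qquad\text{for all }F\in\mathbb R^{n\times n},$$ where the minimum is attained. Let $\Delta L=L_0-L_1$, $L_\theta=\theta L_1+(1-\theta)L_0$, $\tilde L_\theta=\theta L_0+(1-\theta)L_1$, and for an invertible matrix $X$ let $Y(X)$ be the tensor with components $Y(X)_{piqj}=-(L_0)_{piqj}+\mu_1\delta_{pq}(X^{-1})_{ij}$. 1. If $\mu_2+\lambda=0$, then $$L^e(\Omega)=L_\theta-\theta(1-\theta)\,\Delta L\,(\tilde L_\theta+Y(Q))^{-1}\Delta L .$$ If $Q$ is invertible, then $\tilde L_\theta+Y(Q)$ is invertible and this is its inverse. If $Q$ is not invertible, then $\tilde L_\theta+Y(Q+\varepsilon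 I)$ is invertible for all sufficiently small $\varepsilon>0$, the limit $\lim_{\varepsilon\searrow0}(\tilde L_\theta+Y(Q+\varepsilon I))^{-1}$ exists, and $(\tilde L_\theta+Y(Q))^{-1}$ denotes this limit. 2. Suppose that $\mu_2+\lambda\ne0$ and that $I$ lies in the range of $\Delta L$. Let $\Delta L^{-1}I$ be any matrix $A$ with $\Delta L A=I$, and put $D=(1-\theta)-(\mu_1+\mu_2+\lambda)\operatorname{Tr}(\Delta L^{-1}I)$. Then, provided $D\neq0$, $$F\cdot L^e(\Omega)F=F\cdot L_0F+\frac{\theta(\mu_1+\mu_2+\lambda)}{D}(\operatorname{Tr}F)^2$$ for every $F\in\mathbb R^{n\times n}$ with $\operatorname{Tr}F\ne0$ and $$\frac{\Delta L F}{\operatorname{Tr}F}=\frac{(1-\theta)\Delta L Q-(\mu_1+\mu_2+\lambda)I}{D};$$ here the left-hand side $F\cdot L^e(\Omega)F$ is twice the (attained) minimum above for this $F$. -/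

import Mathlib

open MeasureTheory Filter Topology
open scoped ContDiff

noncomputable section

namespace Composite

/-- Euclidean `n`-space. -/
abbrev Space (n : ℕ) := EuclideanSpace ℝ (Fin n)

/-- Real `n × n` matrices. -/
abbrev Mat (n : ℕ) := Matrix (Fin n) (Fin n) ℝ

/-- Fourth order tensors, i.e. linear maps from `n × n` matrices to `n × n` matrices. -/
abbrev Tensor (n : ℕ) := Module.End ℝ (Mat n)

variable {n : ℕ}

/-! ### Tensors -/

/-- The inner product `F · G = ∑ F_{pi} G_{pi}` of matrices. -/
def frob (F G : Mat n) : ℝ := ∑ p, ∑ i, F p i * G p i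

/-- The tensor with components `C_{piqj}`: `(C F)_{pi} = ∑_{q,j} C_{piqj} F_{qj}`. -/
def ofComponents (C : Fin n → Fin n → Fin n → Fin n → ℝ) : Tensor n where
  toFun F := Matrix.of fun p i => ∑ q, ∑ j, C p i q j * F q j
  map_add' F G := by
    ext p i
    simp [mul_add, Finset.sum_add_distrib]
  map_smul' c F := by
    ext p i
    simp [Finset.mul_sum, mul_left_comm]

/-- (Major) symmetry of a tensor. -/
def IsSymmTensor (L : Tensor n) : Prop := ∀ F G, frob F (L G) = frob (L F) G

/-- Positive definiteness on all matrices. -/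
def IsPosDefTensor (L : Tensor n) : Prop := ∀ F, F ≠ 0 → 0 < frob F (L F)

/-- Elasticity tensors: they have symmetric values, see only the symmetric part of their argument,
and are positive definite on symmetric matrices. -/
structure IsElasticityTensor (L : Tensor n) : Prop where
  symm_value : ∀ F, (L F).IsSymm
  symm_arg : ∀ F, L F.transpose = L F
  pos : ∀ F, F.IsSymm → F ≠ 0 → 0 < frob F (L F)

/-- The class of admissible tensors: symmetric, and either positive definite or an elasticity
tensor. -/
def Admissible (L : Tensor n) : Prop :=
  IsSymmTensor L ∧ (IsPosDefTensor L ∨ IsElasticityTensor L)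

/-- The Kronecker delta. -/
def δ (i j : Fin n) : ℝ := if i = j then 1 else 0

/-- The tensor `μ₁ δ_{ij} δ_{pq} + μ₂ δ_{pj} δ_{iq} + lam δ_{ip} δ_{jq}`. -/
def matrixTensor (n : ℕ) (μ₁ μ₂ lam : ℝ) : Tensor n :=
  ofComponents fun p i q j => μ₁ * δ i j * δ p q + μ₂ * δ p j * δ i q + lam * δ i p * δ j q

/-- The tensor `Y(Q)_{piqj} = -(L₀)_{piqj} + μ₁ δ_{pq} (Q⁻¹)_{ij}` (for invertible `Q`). -/
def yTensor (L₀ : Tensor n) (μ₁ : ℝ) (Q : Mat n) : Tensor n :=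
  -L₀ + ofComponents fun p i q j => μ₁ * δ p q * Q⁻¹ i j

/-! ### Lattices, periodic Sobolev functions -/

/-- The open unit cell `{∑ xᵢ eᵢ : 0 < xᵢ < 1}` of the Bravais lattice spanned by the basis `e`. -/
def unitCell (e : Module.Basis (Fin n) ℝ (Space n)) : Set (Space n) :=
  {x | ∀ i, 0 < e.repr x i ∧ e.repr x i < 1}

/-- Lebesgue measure on the unit cell. -/
def cellMeasure (e : Module.Basis (Fin n) ℝ (Space n)) : Measure (Space n) :=
  volume.restrict (unitCell e)

/-- The volume fraction `|Ω| / |Y|`. -/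
def volumeFraction (e : Module.Basis (Fin n) ℝ (Space n)) (Ω : Set (Space n)) : ℝ :=
  volume.real Ω / volume.real (unitCell e)

/-- Smooth functions on `ℝⁿ` that are periodic with respect to the lattice spanned by `e`. -/
def IsPeriodicTest (e : Module.Basis (Fin n) ℝ (Space n)) (φ : Space n → ℝ) : Prop :=
  ContDiff ℝ ∞ φ ∧ ∀ i x, φ (x + e i) = φ x

/-- `∂φ/∂x_j` for a smooth function. -/
def partialDeriv (j : Fin n) (φ : Space n → ℝ) (x : Space n) : ℝ :=
  fderiv ℝ φ x (EuclideanSpace.single j 1)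

/-- `f` is (represented on the unit cell `Y` by) an element of `W^{1,2}_per(Y)`, with weak partial
derivatives `g j`: both are square integrable over `Y`, and `g j` is the distributional derivative
of `f` on the torus `ℝⁿ / lattice`, whose test functions are the smooth periodic functions.
Only values in `Y` matter. -/
structure HasPeriodicWeakGradient (e : Module.Basis (Fin n) ℝ (Space n))
    (f : Space n → ℝ) (g : Fin n → Space n → ℝ) : Prop where
  memLp : MemLp f 2 (cellMeasure e)
  memLp_grad : ∀ j, MemLp (g j) 2 (cellMeasure e)
  weak : ∀ j φ, IsPeriodicTest e φ →
    ∫ x, f x * partialDeriv j φ x ∂(cellMeasure e) = -∫ x, g j x * φ x ∂(cellMeasure e)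

/-- `v ∈ W^{1,2}_per(Y; ℝⁿ)` with weak gradient `G`, `G_{pi} = ∂v_p/∂x_i`. -/
def IsVectorW12per (e : Module.Basis (Fin n) ℝ (Space n))
    (v : Space n → Fin n → ℝ) (G : Space n → Mat n) : Prop :=
  ∀ p, HasPeriodicWeakGradient e (fun x => v x p) (fun i x => G x p i)

/-- `u ∈ W^{2,2}_per(Y)` with weak Hessian `H = ∇∇u`. -/
def IsScalarW22per (e : Module.Basis (Fin n) ℝ (Space n))
    (u : Space n → ℝ) (H : Space n → Mat n) : Prop :=
  ∃ g : Fin n → Space n → ℝ, HasPeriodicWeakGradient e u g ∧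
    ∀ i, HasPeriodicWeakGradient e (g i) (fun j x => H x i j)

/-- The measurable set `Ω ⊆ Y` is (one cell of) a periodic E-inclusion for the matrix `Q`: with
`θ = |Ω|/|Y|` some `u ∈ W^{2,2}_per(Y)` satisfies `Δu = θ - χ_Ω` a.e. on `Y` and
`∇∇u = -(1 - θ) Q` a.e. on `Ω`. -/
structure IsPeriodicEInclusion (e : Module.Basis (Fin n) ℝ (Space n)) (Ω : Set (Space n))
    (Q : Mat n) : Prop where
  measurableSet : MeasurableSet Ω
  subset : Ω ⊆ unitCell e
  exists_potential : ∃ (u : Space n → ℝ) (H : Space n → Mat n), IsScalarW22per e u H ∧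
    (∀ᵐ x ∂(cellMeasure e),
      (H x).trace = volumeFraction e Ω - Ω.indicator (fun _ => (1 : ℝ)) x) ∧
    (∀ᵐ x ∂(volume.restrict Ω), H x = -((1 - volumeFraction e Ω) • Q))

/-! ### Effective tensors -/

open Classical in
/-- The local tensor `L(x, Ω)` of the two-phase composite: `L₁` on `Ω` and `L₀` outside. -/
def localTensor (L₀ L₁ : Tensor n) (Ω : Set (Space n)) (x : Space n) : Tensor n :=
  if x ∈ Ω then L₁ else L₀

/-- The set of all values
`(1/2) ⨍_Y (∇v + F) · L(x, Ω) (∇v + F) dx`, `v ∈ W^{1,2}_per(Y; ℝⁿ)`. -/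
def energyValues (e : Module.Basis (Fin n) ℝ (Space n)) (L₀ L₁ : Tensor n) (Ω : Set (Space n))
    (F : Mat n) : Set ℝ :=
  {E | ∃ (v : Space n → Fin n → ℝ) (G : Space n → Mat n), IsVectorW12per e v G ∧
    E = 1 / 2 * ⨍ x, frob (G x + F) (localTensor L₀ L₁ Ω x (G x + F)) ∂(cellMeasure e)}

/-- `Le` is the effective tensor of the composite: it is symmetric, and `(1/2) F · Le F` is the
minimum (attained) of the energy with average gradient `F`, for every `F`. -/
def IsEffectiveTensor (e : Module.Basis (Fin n) ℝ (Space n)) (L₀ L₁ : Tensor n)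
    (Ω : Set (Space n)) (Le : Tensor n) : Prop :=
  IsSymmTensor Le ∧ ∀ F, IsLeast (energyValues e L₀ L₁ Ω F) (1 / 2 * frob F (Le F))

end Composite

end

open Composite

/-! The idea is to exhibit the minimiser. Let `u` be the potential of the E-inclusion and try the
displacement `B ∇u`, with gradient `B ∇∇u`. On `Ω` this gradient is the constant `-(1 - θ) B Q`.
Against periodic gradients `B ∇∇u` integrates like `-χ_Ω B` (`IsScalarW22per.integral_frob_mul`),
because the row-wise divergence of a Hessian is the gradient of the Laplacian. The energy of `L₀`
reduces, modulo null Lagrangians, to a `μ₁ |∇v|²` term and a `(μ₂ + lam) (div v)²` term. So `L₀ (B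
∇∇u)` is balanced by a uniform polarisation `P` on `Ω` in two cases: if `μ₂ + lam = 0`, with `P = μ₁
B`; or if `B = b I`, with `P = b (μ₁ + μ₂ + lam) I`.

If moreover `ΔL (F + Gc) = -P`, where `Gc` is the gradient on `Ω`, then the true stress `L(x) (∇v +
F)` is in equilibrium. The energy is convex, so `v` minimises, with value `(F · L₀ F + θ F · P) / 2`
(`isLeast_energyValues_of_polarisation`).

For `μ₂ + lam = 0`, put `B = -R`. The matching condition becomes `M R = ΔL F` with `M R = μ₁ R - (1
- θ) ΔL (R Q)`. Invertibility of `M` rests on `RQ · L₀ (RQ) ≤ μ₁ R · RQ`, proved by splitting `R Q`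
into rank-one matrices (`frob_mul_matrixTensor_le`, `isUnit_reducedTensor`). The tensor `θ L₀ + (1 -
θ) L₁ + Y(X)` is the reduced tensor at `X` composed with right multiplication by `X⁻¹`. Its inverse
`F ↦ M⁻¹(F) X` makes sense for singular `X` too, and this is the limit as `ε ↘ 0`. In the second
case the condition imposed on `F` is exactly the matching condition with `b = Tr F / D`. -/

namespace Composite

variable {n : ℕ}

/-! ### Parseval's identity on the unit cell -/

section Fourier

/-- The measure on `ℝ / ℤ` is normalised to total mass one, as in Mathlib's theory of
multiple Fourier series. -/
noncomputable local instance : MeasureSpace UnitAddCircle := ⟨AddCircle.haarAddCircle⟩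

local instance : Measure.IsAddHaarMeasure (volume : Measure UnitAddCircle) :=
  inferInstanceAs (Measure.IsAddHaarMeasure AddCircle.haarAddCircle)

local instance : IsProbabilityMeasure (volume : Measure UnitAddCircle) :=
  inferInstanceAs (IsProbabilityMeasure AddCircle.haarAddCircle)

/-- The parametrisation of (the half-open version of) the unit cell by the standard torus. -/
noncomputable def torusParam (e : Module.Basis (Fin n) ℝ (Space n)) (t : UnitAddTorus (Fin n)) : Space n :=
  e.equivFun.symm (UnitAddTorus.measurableEquivPiIoc (fun _ : Fin n => (0 : ℝ)) t).1

lemma measurableSet_unitCell (e : Module.Basis (Fin n) ℝ (Space n)) :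
    MeasurableSet (unitCell e) := by
  have h : ∀ i, Measurable fun x => e.repr x i := fun i =>
    (LinearMap.continuous_of_finiteDimensional (e.coord i)).measurable
  have : unitCell e = ⋂ i, ({x | 0 < e.repr x i} ∩ {x | e.repr x i < 1}) := by
    ext x; simp [unitCell]
  rw [this]
  exact MeasurableSet.iInter fun i =>
    (measurableSet_lt measurable_const (h i)).inter (measurableSet_lt (h i) measurable_const)

/-- Up to a constant factor, `torusParam` transports Haar measure to Lebesgue measure on the unit
cell. -/
lemma exists_measurePreserving_torusParam (e : Module.Basis (Fin n) ℝ (Space n)) :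
    ∃ c : ENNReal, c ≠ 0 ∧ c ≠ ⊤ ∧
      MeasurePreserving (torusParam e) volume (c • cellMeasure e) := by
  set E : (Fin n → ℝ) ≃L[ℝ] Space n := e.equivFun.symm.toContinuousLinearEquiv with hE
  have hHaar : ((volume : Measure (Fin n → ℝ)).map E).IsAddHaarMeasure := inferInstance
  have hc := Measure.isAddLeftInvariant_eq_smul ((volume : Measure (Fin n → ℝ)).map E)
    (volume : Measure (Space n))
  set c := Measure.addHaarScalarFactor ((volume : Measure (Fin n → ℝ)).map E)
    (volume : Measure (Space n)) with hcdef
  have hcpos : 0 < c := Measure.addHaarScalarFactor_pos_of_isAddHaarMeasure _ _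
  have h1 := UnitAddTorus.measurePreserving_equivPiIoc (fun _ : Fin n => (0 : ℝ))
  have hs : MeasurableSet {x : Fin n → ℝ | ∀ i, x i ∈ Set.Ioc (0 : ℝ) (0 + 1)} :=
    MeasurableSet.univ_pi' (fun i => measurableSet_Ioc)
  have h2 : MeasurePreserving
      (Subtype.val : {x : Fin n → ℝ // ∀ i, x i ∈ Set.Ioc (0 : ℝ) (0 + 1)} → (Fin n → ℝ))
      (Measure.comap Subtype.val volume)
      (volume.restrict {x : Fin n → ℝ | ∀ i, x i ∈ Set.Ioc (0 : ℝ) (0 + 1)}) :=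
    measurePreserving_subtype_coe hs
  -- The torus is modelled on the half-open cube and the cell on the open one; they differ by faces
  -- of measure zero.
  have hae : (volume.restrict {x : Fin n → ℝ | ∀ i, x i ∈ Set.Ioc (0 : ℝ) (0 + 1)}) =
      (volume : Measure (Fin n → ℝ)).restrict (E ⁻¹' unitCell e) := by
    refine Measure.restrict_congr_set ?_
    have a1 := Measure.univ_pi_Ioc_ae_eq_Icc (μ := fun _ : Fin n => (volume : Measure ℝ))
      (f := fun _ => 0) (g := fun _ => 1)
    have a2 := Measure.univ_pi_Ioo_ae_eq_Icc (μ := fun _ : Fin n => (volume : Measure ℝ))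
      (f := fun _ => 0) (g := fun _ => 1)
    have e1 : {x : Fin n → ℝ | ∀ i, x i ∈ Set.Ioc (0 : ℝ) (0 + 1)} =
      Set.pi Set.univ fun _ => Set.Ioc 0 1 := by ext; simp
    have e2 : E ⁻¹' unitCell e = Set.pi Set.univ fun _ => Set.Ioo 0 1 := by
      ext x
      have : ∀ i, e.repr (E x) i = x i := fun i => by
        exact congrFun (e.equivFun.apply_symm_apply x) i
      simp [unitCell, this]
    rw [e1, e2]
    exact a1.trans a2.symm
  have h3 : MeasurePreserving E
      ((volume : Measure (Fin n → ℝ)).restrict (E ⁻¹' unitCell e))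
      (((volume : Measure (Fin n → ℝ)).map E).restrict (unitCell e)) :=
    (E.continuous.measurable.measurePreserving _).restrict_preimage (measurableSet_unitCell e)
  refine ⟨c, by exact_mod_cast hcpos.ne', ENNReal.coe_ne_top, ?_⟩
  have h4 := (h3.comp (hae ▸ h2)).comp h1
  have e5 : (((volume : Measure (Fin n → ℝ)).map E).restrict (unitCell e)) =
      (c : ENNReal) • cellMeasure e := by
    rw [hc, cellMeasure]
    exact Measure.restrict_smul _ _ _
  rw [e5] at h4
  exact h4

/-- The phase `2π k · x` in lattice coordinates. -/
noncomputable def phase (e : Module.Basis (Fin n) ℝ (Space n)) (k : Fin n → ℤ) (x : Space n) : ℝ :=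
  2 * Real.pi * ∑ i, k i * e.repr x i

/-- The (unnormalised) Fourier coefficients of a function on the unit cell. -/
noncomputable def cellCoeff (e : Module.Basis (Fin n) ℝ (Space n)) (f : Space n → ℝ) (k : Fin n → ℤ) : ℂ :=
  ∫ x, Complex.exp (-(phase e k x * Complex.I)) * (f x : ℂ) ∂(cellMeasure e)

lemma continuous_phase (e : Module.Basis (Fin n) ℝ (Space n)) (k : Fin n → ℤ) :
    Continuous (phase e k) := by
  have h : ∀ i, Continuous fun x => e.repr x i := fun i =>
    (LinearMap.continuous_of_finiteDimensional (e.coord i))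
  unfold phase
  fun_prop

/-- A point of the torus is the class modulo 1 of its lattice coordinates, so the torus monomial is
the exponential of the phase, whatever the basis. -/
lemma mFourier_neg_eq_exp (e : Module.Basis (Fin n) ℝ (Space n)) (k : Fin n → ℤ)
    (t : UnitAddTorus (Fin n)) :
    UnitAddTorus.mFourier (-k) t = Complex.exp (-(phase e k (torusParam e t) * Complex.I)) := by
  have h : ∀ i, e.repr (torusParam e t) i =
      (UnitAddTorus.measurableEquivPiIoc (fun _ : Fin n => (0 : ℝ)) t).1 i := fun i =>
    congrFun (e.equivFun.apply_symm_apply _) i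
  have h' : ∀ i, t i = (((UnitAddTorus.measurableEquivPiIoc (fun _ : Fin n => (0 : ℝ)) t).1 i : ℝ) :
      UnitAddCircle) := fun i =>
    (congrFun ((UnitAddTorus.measurableEquivPiIoc (fun _ : Fin n => (0 : ℝ))).symm_apply_apply t)
      i).symm
  set s := (UnitAddTorus.measurableEquivPiIoc (fun _ : Fin n => (0 : ℝ)) t).1
  simp only [UnitAddTorus.mFourier, ContinuousMap.coe_mk, phase, h]
  rw [Finset.prod_congr rfl (fun i _ => by rw [h' i, fourier_coe_apply]), ← Complex.exp_sum]
  congr 1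
  push_cast
  rw [Finset.mul_sum, Finset.sum_mul, ← Finset.sum_neg_distrib]
  refine Finset.sum_congr rfl fun i _ => ?_
  simp
  ring

/-- Parseval's identity on the unit cell, in the form used below: the `L²` product of two functions
depends only on the products of their Fourier coefficients. -/
theorem integral_mul_eq_of_cellCoeff (e : Module.Basis (Fin n) ℝ (Space n))
    {f₁ g₁ f₂ g₂ : Space n → ℝ}
    (hf₁ : MemLp f₁ 2 (cellMeasure e)) (hg₁ : MemLp g₁ 2 (cellMeasure e))
    (hf₂ : MemLp f₂ 2 (cellMeasure e)) (hg₂ : MemLp g₂ 2 (cellMeasure e))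
    (h : ∀ k, starRingEnd ℂ (cellCoeff e f₁ k) * cellCoeff e g₁ k =
      starRingEnd ℂ (cellCoeff e f₂ k) * cellCoeff e g₂ k) :
    ∫ x, f₁ x * g₁ x ∂(cellMeasure e) = ∫ x, f₂ x * g₂ x ∂(cellMeasure e) := by
  obtain ⟨c, hc0, hct, hmp⟩ := exists_measurePreserving_torusParam e
  have hcr : c.toReal ≠ 0 := (ENNReal.toReal_pos hc0 hct).ne'
  have lift : ∀ {f : Space n → ℝ}, MemLp f 2 (cellMeasure e) →
      MemLp (fun t => ((f (torusParam e t) : ℝ) : ℂ)) 2 (volume : Measure (UnitAddTorus (Fin n))) :=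
    fun hf => ((hf.smul_measure hct).comp_measurePreserving hmp).ofReal
  have int : ∀ {F : Space n → ℂ}, AEStronglyMeasurable F (cellMeasure e) →
      ∫ t, F (torusParam e t) = c.toReal * ∫ x, F x ∂(cellMeasure e) := by
    intro F hF
    rw [← integral_map hmp.measurable.aemeasurable
      (by rw [hmp.map_eq]; exact hF.smul_measure c), hmp.map_eq, integral_smul_measure]
    simp
  have coeff : ∀ {f : Space n → ℝ} (hf : MemLp f 2 (cellMeasure e)) (k : Fin n → ℤ),
      UnitAddTorus.mFourierCoeff ((lift hf).toLp _) k = c.toReal * cellCoeff e f k := by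
    intro f hf k
    rw [cellCoeff, ← int]
    · refine integral_congr_ae ?_
      filter_upwards [(lift hf).coeFn_toLp] with t ht
      rw [ht, mFourier_neg_eq_exp e, smul_eq_mul]
    · refine AEStronglyMeasurable.mul (Continuous.aestronglyMeasurable ?_)
        (Complex.continuous_ofReal.comp_aestronglyMeasurable hf.1)
      have := continuous_phase e k
      fun_prop
  have pars : ∀ {f g : Space n → ℝ} (hf : MemLp f 2 (cellMeasure e))
      (hg : MemLp g 2 (cellMeasure e)),
      HasSum (fun k => (c.toReal * c.toReal : ℂ) *
        (starRingEnd ℂ (cellCoeff e f k) * cellCoeff e g k))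
        (c.toReal * ((∫ x, f x * g x ∂(cellMeasure e) : ℝ) : ℂ)) := by
    intro f g hf hg
    have := UnitAddTorus.hasSum_prod_mFourierCoeff ((lift hf).toLp _) ((lift hg).toLp _)
    have hI : ∫ t, starRingEnd ℂ (((lift hf).toLp _) t) * ((lift hg).toLp _) t =
        (c.toReal * ((∫ x, f x * g x ∂(cellMeasure e) : ℝ) : ℂ)) := by
      rw [← integral_complex_ofReal, ← int]
      · refine integral_congr_ae ?_
        filter_upwards [(lift hf).coeFn_toLp, (lift hg).coeFn_toLp] with t ht ht'
        rw [ht, ht']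
        simp
      · exact Complex.continuous_ofReal.comp_aestronglyMeasurable (hf.1.mul hg.1)
    rw [hI] at this
    convert this using 2 with k
    rw [coeff hf, coeff hg]
    simp only [map_mul, Complex.conj_ofReal]
    ring
  -- The two Parseval series agree term by term, and a sum is unique; the nonzero density factor
  -- then cancels.
  have e1 := pars hf₁ hg₁
  have e2 := pars hf₂ hg₂
  simp only [h] at e1
  have := e1.unique e2
  have hcc : (c.toReal : ℂ) ≠ 0 := by exact_mod_cast hcr
  exact_mod_cast mul_left_cancel₀ hcc this

end Fourier

/-! ### Trigonometric test functions and the symbol of weak derivatives -/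

lemma exists_isCompact_unitCell_subset (e : Module.Basis (Fin n) ℝ (Space n)) :
    ∃ K, IsCompact K ∧ unitCell e ⊆ K := by
  let E : (Fin n → ℝ) ≃L[ℝ] Space n := e.equivFun.symm.toContinuousLinearEquiv
  exact ⟨E '' Set.Icc 0 1, isCompact_Icc.image E.continuous, fun x hx =>
    ⟨e.equivFun x, ⟨fun i => (hx i).1.le, fun i => (hx i).2.le⟩, e.equivFun.symm_apply_apply x⟩⟩

instance isFiniteMeasure_cellMeasure (e : Module.Basis (Fin n) ℝ (Space n)) :
    IsFiniteMeasure (cellMeasure e) := by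
  refine ⟨?_⟩
  rw [cellMeasure, Measure.restrict_apply_univ]
  obtain ⟨K, hK, hsub⟩ := exists_isCompact_unitCell_subset e
  exact (hK.isBounded.subset hsub).measure_lt_top

lemma phase_add (e : Module.Basis (Fin n) ℝ (Space n)) (k : Fin n → ℤ) (x y : Space n) :
    phase e k (x + y) = phase e k x + phase e k y := by
  simp [phase, mul_add, Finset.sum_add_distrib]

lemma phase_smul (e : Module.Basis (Fin n) ℝ (Space n)) (k : Fin n → ℤ) (a : ℝ) (x : Space n) :
    phase e k (a • x) = a * phase e k x := by
  simp only [phase, map_smul, Finsupp.smul_apply, smul_eq_mul, Finset.mul_sum]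
  exact Finset.sum_congr rfl fun i _ => by ring

/-- The phase as a continuous linear functional. -/
noncomputable def phaseCLM (e : Module.Basis (Fin n) ℝ (Space n)) (k : Fin n → ℤ) : Space n →L[ℝ] ℝ where
  toFun := phase e k
  map_add' := phase_add e k
  map_smul' := phase_smul e k
  cont := continuous_phase e k

lemma phase_basis (e : Module.Basis (Fin n) ℝ (Space n)) (k : Fin n → ℤ) (i : Fin n) :
    phase e k (e i) = k i * (2 * Real.pi) := by
  simp [phase, Finsupp.single_apply]
  ring

lemma hasFDerivAt_phase (e : Module.Basis (Fin n) ℝ (Space n)) (k : Fin n → ℤ) (x : Space n) :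
    HasFDerivAt (phase e k) (phaseCLM e k) x := (phaseCLM e k).hasFDerivAt

lemma contDiff_phase (e : Module.Basis (Fin n) ℝ (Space n)) (k : Fin n → ℤ) :
    ContDiff ℝ ∞ (phase e k) := (phaseCLM e k).contDiff

lemma isPeriodicTest_cos (e : Module.Basis (Fin n) ℝ (Space n)) (k : Fin n → ℤ) :
    IsPeriodicTest e fun x => Real.cos (phase e k x) :=
  ⟨Real.contDiff_cos.comp (contDiff_phase e k), fun i x => by
    simp only [phase_add, phase_basis, Real.cos_add_int_mul_two_pi]⟩

lemma isPeriodicTest_sin (e : Module.Basis (Fin n) ℝ (Space n)) (k : Fin n → ℤ) :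
    IsPeriodicTest e fun x => Real.sin (phase e k x) :=
  ⟨Real.contDiff_sin.comp (contDiff_phase e k), fun i x => by
    simp only [phase_add, phase_basis, Real.sin_add_int_mul_two_pi]⟩

lemma partialDeriv_cos_phase (e : Module.Basis (Fin n) ℝ (Space n)) (k : Fin n → ℤ) (j : Fin n)
    (x : Space n) : partialDeriv j (fun x => Real.cos (phase e k x)) x =
      -(phase e k (EuclideanSpace.single j 1) * Real.sin (phase e k x)) := by
  rw [partialDeriv, ((hasFDerivAt_phase e k x).cos).fderiv]
  simp [phaseCLM]
  ring

lemma partialDeriv_sin_phase (e : Module.Basis (Fin n) ℝ (Space n)) (k : Fin n → ℤ) (j : Fin n)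
    (x : Space n) : partialDeriv j (fun x => Real.sin (phase e k x)) x =
      phase e k (EuclideanSpace.single j 1) * Real.cos (phase e k x) := by
  rw [partialDeriv, ((hasFDerivAt_phase e k x).sin).fderiv]
  simp [phaseCLM]
  ring

/-- Periodic test functions are real-valued, so the complex coefficient is split into integrals
against cosine and sine, to which the weak derivative identity applies. -/
lemma cellCoeff_eq (e : Module.Basis (Fin n) ℝ (Space n)) {f : Space n → ℝ}
    (hf : MemLp f 2 (cellMeasure e)) (k : Fin n → ℤ) :
    cellCoeff e f k = (∫ x, f x * Real.cos (phase e k x) ∂(cellMeasure e) : ℝ) -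
      (∫ x, f x * Real.sin (phase e k x) ∂(cellMeasure e) : ℝ) * Complex.I := by
  have hint : Integrable f (cellMeasure e) := hf.integrable (by norm_num)
  have hph := continuous_phase e k
  have h1 : Integrable (fun x => f x * Real.cos (phase e k x)) (cellMeasure e) :=
    hint.mul_bdd (c := 1) (Continuous.aestronglyMeasurable (by fun_prop))
      (ae_of_all _ fun x => Real.abs_cos_le_one _)
  have h2 : Integrable (fun x => f x * Real.sin (phase e k x)) (cellMeasure e) :=
    hint.mul_bdd (c := 1) (Continuous.aestronglyMeasurable (by fun_prop))
      (ae_of_all _ fun x => Real.abs_sin_le_one _)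
  rw [← integral_complex_ofReal, ← integral_complex_ofReal, ← integral_mul_const,
    ← integral_sub h1.ofReal (h2.ofReal.mul_const _), cellCoeff]
  congr 1
  ext x
  rw [← neg_mul, ← Complex.ofReal_neg, Complex.exp_mul_I, ← Complex.ofReal_cos,
    ← Complex.ofReal_sin, Real.cos_neg, Real.sin_neg]
  push_cast
  ring

/-- Weak differentiation multiplies Fourier coefficients by the symbol of the derivative. -/
theorem HasPeriodicWeakGradient.cellCoeff_grad {e : Module.Basis (Fin n) ℝ (Space n)}
    {f : Space n → ℝ} {g : Fin n → Space n → ℝ} (h : HasPeriodicWeakGradient e f g)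
    (j : Fin n) (k : Fin n → ℤ) :
    cellCoeff e (g j) k =
      (phase e k (EuclideanSpace.single j 1) : ℝ) * Complex.I * cellCoeff e f k := by
  have hc := h.weak j _ (isPeriodicTest_cos e k)
  have hs := h.weak j _ (isPeriodicTest_sin e k)
  simp only [partialDeriv_cos_phase, partialDeriv_sin_phase] at hc hs
  set p := phase e k (EuclideanSpace.single j 1)
  have hc' : ∫ x, g j x * Real.cos (phase e k x) ∂(cellMeasure e) =
      p * ∫ x, f x * Real.sin (phase e k x) ∂(cellMeasure e) := by
    rw [← integral_const_mul, ← neg_eq_iff_eq_neg.mpr hc, ← integral_neg]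
    congr 1; ext x; ring
  have hs' : ∫ x, g j x * Real.sin (phase e k x) ∂(cellMeasure e) =
      -(p * ∫ x, f x * Real.cos (phase e k x) ∂(cellMeasure e)) := by
    rw [← integral_const_mul, ← neg_eq_iff_eq_neg.mpr hs]
    congr 2; ext x; ring
  rw [cellCoeff_eq e h.memLp, cellCoeff_eq e (h.memLp_grad j), hc', hs']
  push_cast
  linear_combination ((p : ℂ) *
    (∫ x, f x * Real.sin (phase e k x) ∂(cellMeasure e) : ℝ)) * Complex.I_sq

/-- `∂_p f ∂_q w - ∂_q f ∂_p w` is a null Lagrangian. -/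
theorem HasPeriodicWeakGradient.integral_mul_swap {e : Module.Basis (Fin n) ℝ (Space n)}
    {f w : Space n → ℝ} {g r : Fin n → Space n → ℝ} (hf : HasPeriodicWeakGradient e f g)
    (hw : HasPeriodicWeakGradient e w r) (p q : Fin n) :
    ∫ x, g p x * r q x ∂(cellMeasure e) = ∫ x, g q x * r p x ∂(cellMeasure e) := by
  refine integral_mul_eq_of_cellCoeff e (hf.memLp_grad p) (hw.memLp_grad q) (hf.memLp_grad q)
    (hw.memLp_grad p) fun k => ?_
  rw [hf.cellCoeff_grad, hf.cellCoeff_grad, hw.cellCoeff_grad, hw.cellCoeff_grad]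
  -- Both products carry the same factor `ξ_p ξ_q`, where `ξ` is the real frequency vector of `k`.
  simp only [map_mul, Complex.conj_ofReal]
  ring

/-- Weak Hessians are symmetric, tested against square integrable functions. -/
theorem IsScalarW22per.integral_hessian_swap {e : Module.Basis (Fin n) ℝ (Space n)}
    {u : Space n → ℝ} {H : Space n → Mat n} (h : IsScalarW22per e u H) {w : Space n → ℝ}
    (hw : MemLp w 2 (cellMeasure e)) (p q : Fin n) :
    ∫ x, H x p q * w x ∂(cellMeasure e) = ∫ x, H x q p * w x ∂(cellMeasure e) := by
  obtain ⟨g, hu, hg⟩ := h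
  refine integral_mul_eq_of_cellCoeff e ((hg p).memLp_grad q) hw ((hg q).memLp_grad p) hw
    fun k => ?_
  rw [(hg p).cellCoeff_grad, (hg q).cellCoeff_grad, hu.cellCoeff_grad, hu.cellCoeff_grad]
  ring_nf

/-- Weak derivatives of periodic functions have mean zero. -/
theorem HasPeriodicWeakGradient.integral_grad_eq_zero {e : Module.Basis (Fin n) ℝ (Space n)}
    {f : Space n → ℝ} {g : Fin n → Space n → ℝ} (h : HasPeriodicWeakGradient e f g) (j : Fin n) :
    ∫ x, g j x ∂(cellMeasure e) = 0 := by
  have := h.weak j (fun _ => 1) ⟨contDiff_const, fun _ _ => rfl⟩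
  simpa [partialDeriv] using this

/-! ### The Frobenius product -/

lemma frob_comm (F G : Mat n) : frob F G = frob G F := by simp [frob, mul_comm]

lemma frob_add_left (F F' G : Mat n) : frob (F + F') G = frob F G + frob F' G := by
  simp [frob, add_mul, Finset.sum_add_distrib]

lemma frob_add_right (F G G' : Mat n) : frob F (G + G') = frob F G + frob F G' := by
  simp [frob, mul_add, Finset.sum_add_distrib]

lemma frob_sub_left (F F' G : Mat n) : frob (F - F') G = frob F G - frob F' G := by
  simp [frob, sub_mul, Finset.sum_sub_distrib]

lemma frob_sub_right (F G G' : Mat n) : frob F (G - G') = frob F G - frob F G' := by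
  simp [frob, mul_sub, Finset.sum_sub_distrib]

lemma frob_smul_left (c : ℝ) (F G : Mat n) : frob (c • F) G = c * frob F G := by
  simp [frob, mul_assoc, Finset.mul_sum]

lemma frob_smul_right (c : ℝ) (F G : Mat n) : frob F (c • G) = c * frob F G := by
  simp [frob, mul_left_comm, Finset.mul_sum]

lemma frob_sum_left {ι : Type*} (s : Finset ι) (F : ι → Mat n) (G : Mat n) :
    frob (∑ k ∈ s, F k) G = ∑ k ∈ s, frob (F k) G := by
  classical
  induction s using Finset.induction_on with
  | empty => simp [frob]
  | insert a s ha ih => rw [Finset.sum_insert ha, Finset.sum_insert ha, frob_add_left, ih]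

lemma frob_one_left (G : Mat n) : frob 1 G = G.trace := by
  simp [frob, Matrix.one_apply, Matrix.trace]

lemma frob_one_right (G : Mat n) : frob G 1 = G.trace := by
  rw [frob_comm, frob_one_left]

lemma frob_transpose (F G : Mat n) : frob F.transpose G.transpose = frob F G := by
  simp only [frob, Matrix.transpose_apply]
  exact Finset.sum_comm

/-- Admissible tensors are positive semidefinite on all matrices. -/
lemma Admissible.frob_nonneg {L : Tensor n} (h : Admissible L) (F : Mat n) : 0 ≤ frob F (L F) := by
  obtain ⟨hs, hp | hp⟩ := h
  · by_cases hF : F = 0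
    · simp [hF, frob]
    · exact (hp F hF).le
  -- An elasticity tensor sees only the symmetric part `S` of `F`, and its symmetric value pairs
  -- with `F` as with `S`.
  · set S := (1 / 2 : ℝ) • (F + F.transpose) with hS
    have hLS : L S = L F := by
      rw [hS, map_smul, map_add, hp.symm_arg, ← two_smul ℝ (L F), smul_smul]
      norm_num
    have hFS : frob F (L F) = frob S (L S) := by
      have h1 : frob F.transpose (L F) = frob F (L F) := by
        conv_lhs => rw [← hp.symm_value F]
        exact frob_transpose _ _
      rw [hLS, hS, frob_smul_left, frob_add_left, h1]
      ring
    rw [hFS]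
    by_cases h0 : S = 0
    · simp [h0, frob]
    · exact (hp.pos S (by simp [hS, Matrix.IsSymm, add_comm]) h0).le

lemma matrixTensor_apply (μ₁ μ₂ lam : ℝ) (F : Mat n) :
    matrixTensor n μ₁ μ₂ lam F = μ₁ • F + μ₂ • F.transpose + (lam * F.trace) • (1 : Mat n) := by
  ext p i
  simp only [matrixTensor, ofComponents, LinearMap.coe_mk, AddHom.coe_mk, Matrix.of_apply, δ,
    add_mul, Finset.sum_add_distrib, Matrix.add_apply, Matrix.smul_apply, Matrix.transpose_apply,
    Matrix.one_apply, smul_eq_mul, Matrix.trace, Matrix.diag]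
  congr 1
  · simp
  · by_cases h : i = p
    · simp [h, Finset.mul_sum]
    · simp [h, Ne.symm h]

/-! ### Square integrable matrix fields -/

/-- All components of the matrix field `X` are square integrable over the unit cell. -/
def MatL2 (e : Module.Basis (Fin n) ℝ (Space n)) (X : Space n → Mat n) : Prop :=
  ∀ p i, MemLp (fun x => X x p i) 2 (cellMeasure e)

variable {e : Module.Basis (Fin n) ℝ (Space n)}

lemma MatL2.add {X Z : Space n → Mat n} (hX : MatL2 e X) (hZ : MatL2 e Z) :
    MatL2 e fun x => X x + Z x := fun p i => (hX p i).add (hZ p i)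

lemma MatL2.sub {X Z : Space n → Mat n} (hX : MatL2 e X) (hZ : MatL2 e Z) :
    MatL2 e fun x => X x - Z x := fun p i => (hX p i).sub (hZ p i)

lemma MatL2.const (F : Mat n) : MatL2 e fun _ => F := fun _ _ => memLp_const _

lemma MatL2.tensor (T : Tensor n) {X : Space n → Mat n} (hX : MatL2 e X) :
    MatL2 e fun x => T (X x) := by
  intro p i
  have h : ∀ F : Mat n, T F p i = ∑ q, ∑ j, T (Matrix.single q j 1) p i * F q j := by
    intro F
    conv_lhs => rw [Matrix.matrix_eq_sum_single F]
    simp only [map_sum, Matrix.sum_apply]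
    refine Finset.sum_congr rfl fun q _ => Finset.sum_congr rfl fun j _ => ?_
    have : Matrix.single q j (F q j) = F q j • Matrix.single q j (1 : ℝ) := by simp
    rw [this, map_smul, Matrix.smul_apply, smul_eq_mul, mul_comm]
  have h' : (fun x => T (X x) p i) =
      fun x => ∑ q, ∑ j, T (Matrix.single q j 1) p i * X x q j := funext fun x => h (X x)
  rw [h']
  exact memLp_finsetSum _ fun q _ => memLp_finsetSum _ fun j _ => (hX q j).const_mul _

lemma integrable_mul_of_memLp {f g : Space n → ℝ} (hf : MemLp f 2 (cellMeasure e))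
    (hg : MemLp g 2 (cellMeasure e)) : Integrable (fun x => f x * g x) (cellMeasure e) :=
  hf.integrable_mul hg

lemma integral_sum_sum {f : Fin n → Fin n → Space n → ℝ}
    (h : ∀ p i, Integrable (f p i) (cellMeasure e)) :
    ∫ x, ∑ p, ∑ i, f p i x ∂(cellMeasure e) = ∑ p, ∑ i, ∫ x, f p i x ∂(cellMeasure e) := by
  rw [integral_finsetSum _ fun p _ => integrable_finsetSum _ fun i _ => h p i]
  exact Finset.sum_congr rfl fun p _ => integral_finsetSum _ fun i _ => h p i

lemma MatL2.integrable_frob {X Z : Space n → Mat n} (hX : MatL2 e X) (hZ : MatL2 e Z) :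
    Integrable (fun x => frob (X x) (Z x)) (cellMeasure e) :=
  integrable_finsetSum _ fun p _ => integrable_finsetSum _ fun i _ =>
    (hX p i).integrable_mul (hZ p i)

lemma IsVectorW12per.matL2 {v : Space n → Fin n → ℝ} {G : Space n → Mat n}
    (h : IsVectorW12per e v G) : MatL2 e G := fun p i => (h p).memLp_grad i

/-- The characteristic function of a set. -/
noncomputable def charFn (Ω : Set (Space n)) : Space n → ℝ := Ω.indicator fun _ => 1

/-- The composite is treated as the homogeneous medium `L₀` perturbed on `Ω`, so that all dependence
on position sits in the characteristic function. -/
lemma localTensor_apply (L₀ L₁ : Tensor n) (Ω : Set (Space n)) (x : Space n) (F : Mat n) :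
    localTensor L₀ L₁ Ω x F = L₀ F - charFn Ω x • (L₀ - L₁) F := by
  by_cases h : x ∈ Ω <;> simp [localTensor, charFn, h]

lemma MatL2.charFn_smul {Ω : Set (Space n)} (hΩ : MeasurableSet Ω) {X : Space n → Mat n}
    (hX : MatL2 e X) : MatL2 e fun x => charFn Ω x • X x := by
  intro p i
  have : (fun x => (charFn Ω x • X x) p i) = Ω.indicator fun x => X x p i := by
    ext x
    by_cases h : x ∈ Ω <;> simp [charFn, h]
  rw [this]
  exact (hX p i).indicator hΩ

lemma MatL2.localTensor {L₀ L₁ : Tensor n} {Ω : Set (Space n)} (hΩ : MeasurableSet Ω)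
    {X : Space n → Mat n} (hX : MatL2 e X) :
    MatL2 e fun x => localTensor L₀ L₁ Ω x (X x) := by
  simp only [localTensor_apply]
  exact (hX.tensor L₀).sub ((hX.tensor (L₀ - L₁)).charFn_smul hΩ)

lemma integral_charFn {Ω : Set (Space n)} (hΩ : MeasurableSet Ω) (hsub : Ω ⊆ unitCell e) :
    ∫ x, charFn Ω x ∂(cellMeasure e) = volume.real Ω := by
  unfold charFn
  rw [integral_indicator_const _ hΩ, smul_eq_mul, mul_one, cellMeasure,
    measureReal_restrict_apply hΩ, Set.inter_eq_left.mpr hsub]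

lemma cellMeasure_real_univ : (cellMeasure e).real Set.univ = volume.real (unitCell e) := by
  simp [cellMeasure, measureReal_def]

lemma integral_frob {X Z : Space n → Mat n} (hX : MatL2 e X) (hZ : MatL2 e Z) :
    ∫ x, frob (X x) (Z x) ∂(cellMeasure e) =
      ∑ p, ∑ i, ∫ x, X x p i * Z x p i ∂(cellMeasure e) :=
  integral_sum_sum fun p i => integrable_mul_of_memLp (hX p i) (hZ p i)

/-! ### Minimality of equilibrium fields -/

lemma IsVectorW12per.integral_frob_const {v : Space n → Fin n → ℝ} {G : Space n → Mat n}
    (h : IsVectorW12per e v G) (F : Mat n) : ∫ x, frob F (G x) ∂(cellMeasure e) = 0 := by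
  rw [integral_frob (MatL2.const F) h.matL2]
  refine Finset.sum_eq_zero fun p _ => Finset.sum_eq_zero fun i _ => ?_
  rw [integral_const_mul, (h p).integral_grad_eq_zero i, mul_zero]

/-- If the strain `G` is constant on the inclusion and `L₀ G` is in equilibrium with
a uniform polarisation `P` on the inclusion which is matched to the jump of the moduli, then `G`
minimises the energy. -/
theorem isLeast_energyValues_of_polarisation {L₀ L₁ : Tensor n} {Ω : Set (Space n)}
    (hL₀ : Admissible L₀) (hL₁ : Admissible L₁) (hΩ : MeasurableSet Ω) (hsub : Ω ⊆ unitCell e)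
    (hcell : volume.real (unitCell e) ≠ 0)
    {v : Space n → Fin n → ℝ} {G : Space n → Mat n} (hG : IsVectorW12per e v G)
    {F Gc P : Mat n} (hGc : ∀ᵐ x ∂(volume.restrict Ω), G x = Gc)
    (heq : ∀ (w : Space n → Fin n → ℝ) (R : Space n → Mat n), IsVectorW12per e w R →
      ∫ x, frob (L₀ (G x)) (R x) ∂(cellMeasure e) =
        -∫ x, charFn Ω x * frob P (R x) ∂(cellMeasure e))
    (hP : (L₀ - L₁) (F + Gc) = -P) :
    IsLeast (energyValues e L₀ L₁ Ω F)
      (1 / 2 * (frob F (L₀ F) + volumeFraction e Ω * frob F P)) := by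
  have hGL := hG.matL2
  have hS : MatL2 e fun x => G x + F := hGL.add (MatL2.const F)
  have hLS : MatL2 e fun x => localTensor L₀ L₁ Ω x (G x + F) := hS.localTensor hΩ
  have hGc' : ∀ᵐ x ∂(cellMeasure e), x ∈ Ω → G x = Gc := by
    have h1 : ∀ᵐ x ∂(volume : Measure (Space n)), x ∈ Ω → G x = Gc :=
      (ae_restrict_iff' hΩ).mp hGc
    exact ae_restrict_of_ae h1
  -- By `hP` the perturbation `-χ_Ω ΔL (G + F)` of the stress is exactly the polarisation `χ_Ω P`.
  have hstress : ∀ᵐ x ∂(cellMeasure e), localTensor L₀ L₁ Ω x (G x + F) =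
      L₀ (G x) + L₀ F + charFn Ω x • P := by
    filter_upwards [hGc'] with x hx
    rw [localTensor_apply, map_add]
    by_cases h : x ∈ Ω
    · rw [hx h, add_comm Gc F, hP]; simp [charFn, h]
    · simp [charFn, h]
  have hsymL : ∀ x (A B : Mat n),
      frob A (localTensor L₀ L₁ Ω x B) = frob (localTensor L₀ L₁ Ω x A) B := by
    intro x A B
    unfold localTensor
    split_ifs
    · exact hL₁.1 A B
    · exact hL₀.1 A B
  have hposL : ∀ x (A : Mat n), 0 ≤ frob A (localTensor L₀ L₁ Ω x A) := by
    intro x A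
    unfold localTensor
    split_ifs
    · exact hL₁.frob_nonneg A
    · exact hL₀.frob_nonneg A
  -- Equilibrium of the true stress: `L₀ G` cancels the polarisation by `heq`, and the constant
  -- stress `L₀ F` has zero work on a periodic gradient.
  have hEL : ∀ (w : Space n → Fin n → ℝ) (R : Space n → Mat n), IsVectorW12per e w R →
      ∫ x, frob (localTensor L₀ L₁ Ω x (G x + F)) (R x) ∂(cellMeasure e) = 0 := by
    intro w R hR
    have hRL := hR.matL2
    have i1 := (hGL.tensor L₀).integrable_frob hRL
    have i2 := (MatL2.const (L₀ F)).integrable_frob hRL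
    have i3 : Integrable (fun x => charFn Ω x * frob P (R x)) (cellMeasure e) := by
      have := ((MatL2.const P).charFn_smul hΩ).integrable_frob hRL
      simpa only [frob_smul_left] using this
    have : ∫ x, frob (localTensor L₀ L₁ Ω x (G x + F)) (R x) ∂(cellMeasure e) =
        ∫ x, (frob (L₀ (G x)) (R x) + frob (L₀ F) (R x)) + charFn Ω x * frob P (R x)
          ∂(cellMeasure e) := by
      refine integral_congr_ae ?_
      filter_upwards [hstress] with x hx
      rw [hx, frob_add_left, frob_add_left, frob_smul_left]
    have i12 : Integrable (fun x => frob (L₀ (G x)) (R x) + frob (L₀ F) (R x))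
        (cellMeasure e) := i1.add i2
    rw [this, integral_add i12 i3, integral_add i1 i2, heq w R hR,
      hR.integral_frob_const]
    ring
  have hmin : ∫ x, frob (G x + F) (localTensor L₀ L₁ Ω x (G x + F)) ∂(cellMeasure e) =
      volume.real (unitCell e) * frob F (L₀ F) + volume.real Ω * frob F P := by
    have i0 := hGL.integrable_frob hLS
    have i1 : Integrable (fun _ : Space n => frob F (L₀ F)) (cellMeasure e) := integrable_const _
    have i2 := (MatL2.const (L₀ F)).integrable_frob hGL
    have i3 : Integrable (fun x => charFn Ω x * frob F P) (cellMeasure e) := by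
      have := ((MatL2.const F).charFn_smul hΩ).integrable_frob (MatL2.const (e := e) P)
      simpa only [frob_smul_left] using this
    have i4 := (MatL2.const (e := e) F).integrable_frob hLS
    -- The minimiser's own gradient is an admissible test field, so only the pairing of the stress
    -- with `F` contributes.
    have h0 : ∫ x, frob (G x) (localTensor L₀ L₁ Ω x (G x + F)) ∂(cellMeasure e) = 0 := by
      simp only [frob_comm (G _)]
      exact hEL v G hG
    have h1 : ∫ x, frob F (localTensor L₀ L₁ Ω x (G x + F)) ∂(cellMeasure e) =
        ∫ x, (frob F (L₀ F) + frob (L₀ F) (G x)) + charFn Ω x * frob F P ∂(cellMeasure e) := by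
      refine integral_congr_ae ?_
      filter_upwards [hstress] with x hx
      rw [hx, frob_add_right, frob_add_right, frob_smul_right, hL₀.1 F (G x)]
      ring
    simp only [frob_add_left]
    have i12 : Integrable (fun x => frob F (L₀ F) + frob (L₀ F) (G x)) (cellMeasure e) :=
      i1.add i2
    rw [integral_add i0 i4, h0, h1, integral_add i12 i3, integral_add i1 i2,
      hG.integral_frob_const, integral_const, integral_mul_const, integral_charFn hΩ hsub,
      cellMeasure_real_univ, smul_eq_mul]
    ring
  refine ⟨⟨v, G, hG, ?_⟩, ?_⟩
  · rw [average_eq, hmin, cellMeasure_real_univ, volumeFraction, smul_eq_mul]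
    field_simp
  · rintro E ⟨w, R, hR, rfl⟩
    have hRL := hR.matL2
    have hcomp : ∫ x, frob (G x + F) (localTensor L₀ L₁ Ω x (G x + F)) ∂(cellMeasure e) ≤
        ∫ x, frob (R x + F) (localTensor L₀ L₁ Ω x (R x + F)) ∂(cellMeasure e) := by
      have iG := hS.integrable_frob hLS
      have iR := (hRL.add (MatL2.const F)).integrable_frob
        (MatL2.localTensor (L₀ := L₀) (L₁ := L₁) hΩ (hRL.add (MatL2.const F)))
      have c1 := hLS.integrable_frob hRL
      have c2 := hLS.integrable_frob hGL
      have c12 : Integrable (fun x => 2 * (frob (localTensor L₀ L₁ Ω x (G x + F)) (R x) -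
          frob (localTensor L₀ L₁ Ω x (G x + F)) (G x))) (cellMeasure e) :=
        (c1.sub c2).const_mul 2
      -- The first-order variation vanishes by equilibrium, so the tangent approximation at `G` has
      -- the same integral as the energy of `G`. Pointwise it lies below the energy of `R`, the gap
      -- being the quadratic form at `R - G`; semidefiniteness is enough here.
      have hcross : ∫ x, frob (G x + F) (localTensor L₀ L₁ Ω x (G x + F)) +
          2 * (frob (localTensor L₀ L₁ Ω x (G x + F)) (R x) -
            frob (localTensor L₀ L₁ Ω x (G x + F)) (G x)) ∂(cellMeasure e) =
          ∫ x, frob (G x + F) (localTensor L₀ L₁ Ω x (G x + F)) ∂(cellMeasure e) := by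
        rw [integral_add iG c12, integral_const_mul, integral_sub c1 c2,
          hEL w R hR, hEL v G hG]
        ring
      rw [← hcross]
      refine integral_mono (iG.add c12) iR fun x => ?_
      have hp := hposL x (R x - G x)
      set T := localTensor L₀ L₁ Ω x
      have e1 : R x + F = (G x + F) + (R x - G x) := by abel
      have e2 : frob (R x - G x) (T (G x + F)) = frob (T (G x + F)) (R x - G x) := frob_comm _ _
      have e3 : frob (G x + F) (T (R x - G x)) = frob (T (G x + F)) (R x - G x) :=
        hsymL x _ _
      have e4 : frob (R x + F) (T (R x + F)) = frob (G x + F) (T (G x + F)) +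
          2 * (frob (T (G x + F)) (R x) - frob (T (G x + F)) (G x)) +
          frob (R x - G x) (T (R x - G x)) := by
        rw [e1, map_add T (G x + F), frob_add_left (G x + F), frob_add_right, frob_add_right, e2,
          e3, frob_sub_right (T (G x + F))]
        ring
      show frob (G x + F) (T (G x + F)) +
          2 * (frob (T (G x + F)) (R x) - frob (T (G x + F)) (G x)) ≤ frob (R x + F) (T (R x + F))
      linarith
    have hexp : (1 / 2 : ℝ) * (frob F (L₀ F) + volumeFraction e Ω * frob F P) =
        1 / 2 * ((volume.real (unitCell e))⁻¹ *
          ∫ x, frob (G x + F) (localTensor L₀ L₁ Ω x (G x + F)) ∂(cellMeasure e)) := by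
      rw [hmin, volumeFraction]
      field_simp
    rw [hexp, average_eq, cellMeasure_real_univ, smul_eq_mul]
    have hinv : 0 ≤ (volume.real (unitCell e))⁻¹ := inv_nonneg.mpr measureReal_nonneg
    gcongr

/-! ### Fields generated by the potential of an E-inclusion -/

lemma HasPeriodicWeakGradient.const_mul {f : Space n → ℝ} {g : Fin n → Space n → ℝ}
    (h : HasPeriodicWeakGradient e f g) (c : ℝ) :
    HasPeriodicWeakGradient e (fun x => c * f x) (fun j x => c * g j x) where
  memLp := h.memLp.const_mul c
  memLp_grad j := (h.memLp_grad j).const_mul c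
  weak j φ hφ := by
    simp only [mul_assoc, integral_const_mul, h.weak j φ hφ, mul_neg]

lemma IsPeriodicTest.memLp_cell {φ : Space n → ℝ} (hφ : IsPeriodicTest e φ) :
    MemLp φ 2 (cellMeasure e) ∧ ∀ j, MemLp (partialDeriv j φ) 2 (cellMeasure e) := by
  have key : ∀ ψ : Space n → ℝ, Continuous ψ → MemLp ψ 2 (cellMeasure e) := by
    intro ψ hψ
    obtain ⟨K, hK, hsub⟩ := exists_isCompact_unitCell_subset e
    obtain ⟨C, hC⟩ := hK.exists_bound_of_continuousOn hψ.continuousOn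
    refine MemLp.of_bound hψ.aestronglyMeasurable C ?_
    exact (ae_restrict_iff' (measurableSet_unitCell e)).mpr
      (ae_of_all _ fun x hx => hC x (hsub hx))
  refine ⟨key φ hφ.1.continuous, fun j => key _ ?_⟩
  have := hφ.1.continuous_fderiv (by simp)
  unfold partialDeriv
  fun_prop

lemma HasPeriodicWeakGradient.sum {ι : Type*} (s : Finset ι) {f : ι → Space n → ℝ}
    {g : ι → Fin n → Space n → ℝ} (h : ∀ k ∈ s, HasPeriodicWeakGradient e (f k) (g k)) :
    HasPeriodicWeakGradient e (fun x => ∑ k ∈ s, f k x) (fun j x => ∑ k ∈ s, g k j x) where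
  memLp := memLp_finsetSum _ fun k hk => (h k hk).memLp
  memLp_grad j := memLp_finsetSum _ fun k hk => (h k hk).memLp_grad j
  weak j φ hφ := by
    obtain ⟨h0, h1⟩ := hφ.memLp_cell
    simp only [Finset.sum_mul]
    rw [integral_finsetSum _ fun k hk => integrable_mul_of_memLp (h k hk).memLp (h1 j),
      integral_finsetSum _ fun k hk => integrable_mul_of_memLp ((h k hk).memLp_grad j) h0,
      ← Finset.sum_neg_distrib]
    exact Finset.sum_congr rfl fun k hk => (h k hk).weak j φ hφ

/-- `B ∇u` is a periodic displacement with gradient `B ∇∇u`. -/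
lemma IsScalarW22per.exists_isVectorW12per {u : Space n → ℝ} {H : Space n → Mat n}
    (h : IsScalarW22per e u H) (B : Mat n) :
    ∃ v, IsVectorW12per e v fun x => B * H x := by
  obtain ⟨g, -, hg⟩ := h
  refine ⟨fun x p => ∑ q, B p q * g q x, fun p => ?_⟩
  simp only [Matrix.mul_apply]
  exact HasPeriodicWeakGradient.sum _ fun q _ => (hg q).const_mul (B p q)

/-- The row-wise weak divergence of the Hessian is the gradient of the Laplacian. -/
lemma IsScalarW22per.integral_hessian_row {u : Space n → ℝ} {H : Space n → Mat n}
    (h : IsScalarW22per e u H) {Ω : Set (Space n)} {θ : ℝ} (hΩ : MeasurableSet Ω)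
    (htr : ∀ᵐ x ∂(cellMeasure e), (H x).trace = θ - charFn Ω x)
    {w : Space n → ℝ} {r : Fin n → Space n → ℝ} (hw : HasPeriodicWeakGradient e w r) (q : Fin n) :
    ∑ i, ∫ x, H x q i * r i x ∂(cellMeasure e) =
      -∫ x, charFn Ω x * r q x ∂(cellMeasure e) := by
  have hg := h
  obtain ⟨g, -, hg⟩ := hg
  -- First `∂_i ∂_q u` is replaced by `∂_q ∂_i u`, then the null Lagrangian moves the outer
  -- derivative from `q` to `i`. Summing over `i` produces the Laplacian.
  have h1 : ∀ i, ∫ x, H x q i * r i x ∂(cellMeasure e) = ∫ x, H x i i * r q x ∂(cellMeasure e) :=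
    fun i => (h.integral_hessian_swap (hw.memLp_grad i) q i).trans
      ((hg i).integral_mul_swap hw q i)
  have hrq : Integrable (r q) (cellMeasure e) := (hw.memLp_grad q).integrable (by norm_num)
  have hχ : Integrable (fun x => charFn Ω x * r q x) (cellMeasure e) := by
    have : (fun x => charFn Ω x * r q x) = Ω.indicator (r q) := by
      ext x
      by_cases h : x ∈ Ω <;> simp [charFn, h]
    rw [this]
    exact hrq.indicator hΩ
  simp only [h1]
  refine (integral_finsetSum Finset.univ fun i _ =>
    integrable_mul_of_memLp ((hg i).memLp_grad i) (hw.memLp_grad q)).symm.trans ?_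
  have : ∫ x, ∑ i, H x i i * r q x ∂(cellMeasure e) =
      ∫ x, θ * r q x - charFn Ω x * r q x ∂(cellMeasure e) := by
    refine integral_congr_ae ?_
    filter_upwards [htr] with x hx
    rw [← Finset.sum_mul, ← sub_mul, ← hx]
    rfl
  rw [this, integral_sub (hrq.const_mul θ) hχ, integral_const_mul, hw.integral_grad_eq_zero]
  ring

lemma IsScalarW22per.matL2 {u : Space n → ℝ} {H : Space n → Mat n}
    (h : IsScalarW22per e u H) : MatL2 e H := by
  obtain ⟨g, -, hg⟩ := h
  exact fun p i => (hg p).memLp_grad i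

/-- The row identity for the Hessian, weighted by the entries of `B`. It turns the potential of an
E-inclusion into a uniform polarisation supported on `Ω`. -/
lemma IsScalarW22per.integral_frob_mul {u : Space n → ℝ} {H : Space n → Mat n}
    (h : IsScalarW22per e u H) {Ω : Set (Space n)} {θ : ℝ} (hΩ : MeasurableSet Ω)
    (htr : ∀ᵐ x ∂(cellMeasure e), (H x).trace = θ - charFn Ω x)
    {w : Space n → Fin n → ℝ} {R : Space n → Mat n} (hR : IsVectorW12per e w R) (B : Mat n) :
    ∫ x, frob (B * H x) (R x) ∂(cellMeasure e) =
      -∫ x, charFn Ω x * frob B (R x) ∂(cellMeasure e) := by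
  obtain ⟨v, hv⟩ := h.exists_isVectorW12per B
  have hRL := hR.matL2
  have hχ : ∫ x, charFn Ω x * frob B (R x) ∂(cellMeasure e) =
      ∑ p, ∑ q, B p q * ∫ x, charFn Ω x * R x p q ∂(cellMeasure e) := by
    have := integral_frob (MatL2.const (e := e) B) (hRL.charFn_smul hΩ)
    simpa only [frob_smul_right, Matrix.smul_apply, smul_eq_mul, integral_const_mul] using this
  rw [integral_frob hv.matL2 hRL, hχ, ← Finset.sum_neg_distrib]
  refine Finset.sum_congr rfl fun p _ => ?_
  have h1 : ∀ i, ∫ x, (B * H x) p i * R x p i ∂(cellMeasure e) =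
      ∑ q, B p q * ∫ x, H x q i * R x p i ∂(cellMeasure e) := by
    intro i
    simp only [Matrix.mul_apply, Finset.sum_mul, mul_assoc]
    refine (integral_finsetSum Finset.univ fun q _ =>
      (integrable_mul_of_memLp (h.matL2 q i) (hRL p i)).const_mul _).trans ?_
    simp only [integral_const_mul]
  simp only [h1]
  rw [Finset.sum_comm, ← Finset.sum_neg_distrib]
  refine Finset.sum_congr rfl fun q _ => ?_
  rw [← Finset.mul_sum, h.integral_hessian_row hΩ htr (hR p) q]
  ring

/-- Up to null Lagrangians, the energy of `matrixTensor` is `μ₁ |∇v|² + (μ₂ + lam) (div v)²`. -/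
lemma IsVectorW12per.integral_frob_matrixTensor {v w : Space n → Fin n → ℝ}
    {G R : Space n → Mat n} (hG : IsVectorW12per e v G) (hR : IsVectorW12per e w R)
    (μ₁ μ₂ lam : ℝ) :
    ∫ x, frob (matrixTensor n μ₁ μ₂ lam (G x)) (R x) ∂(cellMeasure e) =
      μ₁ * ∫ x, frob (G x) (R x) ∂(cellMeasure e) +
        (μ₂ + lam) * ∫ x, frob ((G x).trace • (1 : Mat n)) (R x) ∂(cellMeasure e) := by
  have hGL := hG.matL2
  have hRL := hR.matL2
  have hGT : MatL2 e fun x => (G x).transpose := fun p i => hGL i p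
  have hGt : MatL2 e fun x => (G x).trace • (1 : Mat n) := by
    intro p i
    have : MemLp (fun x => (G x).trace) 2 (cellMeasure e) :=
      memLp_finsetSum _ fun p _ => hGL p p
    exact this.mul_const _
  -- The integrand `∂_p v_i ∂_i w_p` becomes `∂_i v_i ∂_p w_p` after the swap, so the `μ₂` and `lam`
  -- terms merge.
  have hnull : ∫ x, frob ((G x).transpose) (R x) ∂(cellMeasure e) =
      ∫ x, frob ((G x).trace • (1 : Mat n)) (R x) ∂(cellMeasure e) := by
    have h2 : ∀ x, frob ((G x).trace • (1 : Mat n)) (R x) = ∑ p, ∑ i, G x i i * R x p p := by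
      intro x
      rw [frob_smul_left, frob_one_left, Matrix.trace, Matrix.trace, Finset.sum_mul_sum,
        Finset.sum_comm]
      rfl
    simp only [h2]
    rw [integral_frob hGT hRL]
    refine Eq.trans ?_
      (integral_sum_sum fun p i => integrable_mul_of_memLp (hGL i i) (hRL p p)).symm
    exact Finset.sum_congr rfl fun p _ => Finset.sum_congr rfl fun i _ =>
      (hG i).integral_mul_swap (hR p) p i
  simp only [matrixTensor_apply, frob_add_left, mul_smul, frob_smul_left lam,
    frob_smul_left μ₁, frob_smul_left μ₂]
  have i1 := hGL.integrable_frob hRL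
  have i2 := hGT.integrable_frob hRL
  have i3 := hGt.integrable_frob hRL
  have i12 : Integrable (fun x => μ₁ * frob (G x) (R x) + μ₂ * frob (G x).transpose (R x))
      (cellMeasure e) := (i1.const_mul _).add (i2.const_mul _)
  rw [integral_add i12 (i3.const_mul _),
    integral_add (i1.const_mul _) (i2.const_mul _), integral_const_mul, integral_const_mul,
    integral_const_mul, hnull]
  ring

/-! ### Minimisers built from the potential of an E-inclusion -/

/-- The minimal energy of an E-inclusion when `μ₂ + lam = 0`. -/
theorem IsPeriodicEInclusion.isLeast_energyValues_of_add_eq_zero {μ₁ μ₂ lam : ℝ} {L₁ : Tensor n}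
    {Ω : Set (Space n)} {Q : Mat n} (hL₀ : Admissible (matrixTensor n μ₁ μ₂ lam))
    (hL₁ : Admissible L₁) (h : IsPeriodicEInclusion e Ω Q)
    (hcell : volume.real (unitCell e) ≠ 0) (h0 : μ₂ + lam = 0) {F B : Mat n}
    (hB : (matrixTensor n μ₁ μ₂ lam - L₁) (F - (1 - volumeFraction e Ω) • (B * Q)) = -(μ₁ • B)) :
    IsLeast (energyValues e (matrixTensor n μ₁ μ₂ lam) L₁ Ω F)
      (1 / 2 * (frob F (matrixTensor n μ₁ μ₂ lam F) +
        volumeFraction e Ω * frob F (μ₁ • B))) := by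
  obtain ⟨u, H, hu, htr, hH⟩ := h.exists_potential
  obtain ⟨v, hv⟩ := hu.exists_isVectorW12per B
  refine isLeast_energyValues_of_polarisation hL₀ hL₁ h.measurableSet h.subset hcell hv
    (Gc := -((1 - volumeFraction e Ω) • (B * Q))) ?_ ?_ (by rw [← sub_eq_add_neg, hB])
  · filter_upwards [hH] with x hx
    rw [hx, mul_neg, Matrix.mul_smul]
  · intro w R hR
    -- The divergence term drops out, so `B` may be arbitrary and the polarisation is `μ₁ B`.
    rw [hv.integral_frob_matrixTensor hR, h0,
      hu.integral_frob_mul h.measurableSet htr hR]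
    simp only [frob_smul_left, mul_left_comm _ μ₁, integral_const_mul]
    ring

/-- The minimal energy of an E-inclusion for special average strains. -/
theorem IsPeriodicEInclusion.isLeast_energyValues_of_scalar {μ₁ μ₂ lam : ℝ} {L₁ : Tensor n}
    {Ω : Set (Space n)} {Q : Mat n} (hL₀ : Admissible (matrixTensor n μ₁ μ₂ lam))
    (hL₁ : Admissible L₁) (h : IsPeriodicEInclusion e Ω Q)
    (hcell : volume.real (unitCell e) ≠ 0) {F : Mat n} {b : ℝ}
    (hb : (matrixTensor n μ₁ μ₂ lam - L₁) (F - (1 - volumeFraction e Ω) • (b • Q)) =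
      -((b * (μ₁ + μ₂ + lam)) • (1 : Mat n))) :
    IsLeast (energyValues e (matrixTensor n μ₁ μ₂ lam) L₁ Ω F)
      (1 / 2 * (frob F (matrixTensor n μ₁ μ₂ lam F) +
        volumeFraction e Ω * frob F ((b * (μ₁ + μ₂ + lam)) • (1 : Mat n)))) := by
  obtain ⟨u, H, hu, htr, hH⟩ := h.exists_potential
  obtain ⟨v, hv⟩ := hu.exists_isVectorW12per (b • (1 : Mat n))
  refine isLeast_energyValues_of_polarisation hL₀ hL₁ h.measurableSet h.subset hcell hv
    (Gc := -((1 - volumeFraction e Ω) • (b • Q))) ?_ ?_ (by rw [← sub_eq_add_neg, hb])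
  · filter_upwards [hH] with x hx
    rw [hx, Matrix.smul_mul, one_mul, smul_neg, smul_comm b]
  · intro w R hR
    -- For `B = b I` the divergence is `b (θ - χ_Ω)`. Its constant part is invisible to periodic
    -- gradients, so the divergence term is again a uniform polarisation on `Ω`.
    have htrace : ∫ x, frob (((b • (1 : Mat n)) * H x).trace • (1 : Mat n)) (R x)
        ∂(cellMeasure e) = -∫ x, charFn Ω x * frob (b • (1 : Mat n)) (R x) ∂(cellMeasure e) := by
      have hRL := hR.matL2
      have i1 := (MatL2.const (b • (1 : Mat n))).integrable_frob hRL
      have i2 : Integrable (fun x => charFn Ω x * frob (b • (1 : Mat n)) (R x))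
          (cellMeasure e) := by
        have := ((MatL2.const (b • (1 : Mat n))).charFn_smul h.measurableSet).integrable_frob hRL
        simpa only [frob_smul_left _ (b • (1 : Mat n))] using this
      have : ∫ x, frob (((b • (1 : Mat n)) * H x).trace • (1 : Mat n)) (R x) ∂(cellMeasure e) =
          ∫ x, volumeFraction e Ω * frob (b • (1 : Mat n)) (R x) -
            charFn Ω x * frob (b • (1 : Mat n)) (R x) ∂(cellMeasure e) := by
        refine integral_congr_ae ?_
        filter_upwards [htr] with x hx
        simp only [Matrix.smul_mul, one_mul, Matrix.trace_smul, hx, frob_smul_left, smul_eq_mul,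
          charFn]
        ring
      rw [this, integral_sub (i1.const_mul _) i2, integral_const_mul, hR.integral_frob_const]
      ring
    rw [hv.integral_frob_matrixTensor hR, htrace,
      hu.integral_frob_mul h.measurableSet htr hR]
    simp only [frob_smul_left, mul_left_comm _ b, mul_left_comm _ (b * (μ₁ + μ₂ + lam)),
      integral_const_mul]
    ring

/-! ### The reduced tensor -/

-- The rows `c_k` of `C` give `Q = ∑ c_k ⊗ c_k` and `Tr Q = ∑ |c_k|²`, the weights of the rank-one
-- decomposition below.
open scoped MatrixOrder ComplexOrder in
lemma exists_eq_transpose_mul_self {Q : Mat n} (hQ : Q.PosSemidef) :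
    ∃ C : Mat n, Q = C.transpose * C := by
  obtain ⟨C, hC⟩ := CStarAlgebra.nonneg_iff_eq_star_mul_self.mp hQ.nonneg
  exact ⟨C, by rw [hC, Matrix.star_eq_conjTranspose, Matrix.conjTranspose_eq_transpose_of_trivial]⟩

lemma frob_self_nonneg (F : Mat n) : 0 ≤ frob F F :=
  Finset.sum_nonneg fun _ _ => Finset.sum_nonneg fun _ _ => mul_self_nonneg _

lemma frob_self_eq_zero {F : Mat n} (h : frob F F = 0) : F = 0 := by
  ext p i
  have h1 := (Finset.sum_eq_zero_iff_of_nonneg fun p _ =>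
    Finset.sum_nonneg fun i _ => mul_self_nonneg (F p i)).mp h p (Finset.mem_univ p)
  exact mul_self_eq_zero.mp ((Finset.sum_eq_zero_iff_of_nonneg fun i _ =>
    mul_self_nonneg (F p i)).mp h1 i (Finset.mem_univ i))

lemma frob_mul_right (F G C : Mat n) : frob F (G * C) = frob (F * C.transpose) G := by
  simp only [frob, Matrix.mul_apply, Matrix.transpose_apply, Finset.mul_sum, Finset.sum_mul]
  refine Finset.sum_congr rfl fun p _ => ?_
  rw [Finset.sum_comm]
  exact Finset.sum_congr rfl fun i _ => Finset.sum_congr rfl fun j _ => by ring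

lemma Admissible.pos_of_isSymm {L : Tensor n} (h : Admissible L) {F : Mat n} (hF : F.IsSymm)
    (h0 : F ≠ 0) : 0 < frob F (L F) :=
  h.2.elim (fun hp => hp F h0) fun hp => hp.pos F hF h0

/-- Test with `e_i ⊗ e_i`: it is symmetric, so both kinds of admissible tensor are strictly positive
on it. When `μ₂ + lam = 0` this yields `μ₁ > 0`. -/
lemma Admissible.sum_moduli_pos {μ₁ μ₂ lam : ℝ} (h : Admissible (matrixTensor n μ₁ μ₂ lam))
    (i : Fin n) : 0 < μ₁ + μ₂ + lam := by
  have h0 : (Matrix.single i i (1 : ℝ) : Mat n) ≠ 0 := fun hz => by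
    have := congrFun (congrFun hz i) i
    simp at this
  have := h.pos_of_isSymm (F := Matrix.single i i 1) (by simp [Matrix.IsSymm]) h0
  rw [matrixTensor_apply, frob_add_right, frob_add_right, frob_smul_right, frob_smul_right,
    frob_smul_right, frob_one_right, Matrix.transpose_single, Matrix.trace_single_eq_same] at this
  have h1 : frob (Matrix.single i i (1 : ℝ)) (Matrix.single i i 1) = 1 := by
    simp only [frob, Matrix.single_apply]
    rw [Finset.sum_eq_single i (fun b _ hb => by simp [Ne.symm hb]) (by simp),
      Finset.sum_eq_single i (fun b _ hb => by simp [Ne.symm hb]) (by simp)]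
    simp
  rw [h1] at this
  linarith

lemma frob_vecMulVec (a b c d : Fin n → ℝ) :
    frob (Matrix.vecMulVec a b) (Matrix.vecMulVec c d) = (a ⬝ᵥ c) * (b ⬝ᵥ d) := by
  simp only [frob, Matrix.vecMulVec_apply, dotProduct, Finset.sum_mul_sum]
  exact Finset.sum_congr rfl fun p _ => Finset.sum_congr rfl fun i _ => by ring

/-- On `a ⊗ c` the transpose and trace terms both contribute multiples of `(a · c)²`, which cancel
when `μ₂ + lam = 0`. -/
lemma frob_matrixTensor_vecMulVec {μ₁ μ₂ lam : ℝ} (h0 : μ₂ + lam = 0) (a c : Fin n → ℝ) :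
    frob (Matrix.vecMulVec a c) (matrixTensor n μ₁ μ₂ lam (Matrix.vecMulVec a c)) =
      μ₁ * ((a ⬝ᵥ a) * (c ⬝ᵥ c)) := by
  rw [matrixTensor_apply, frob_add_right, frob_add_right, frob_smul_right, frob_smul_right,
    frob_smul_right, frob_one_right, Matrix.transpose_vecMulVec, frob_vecMulVec, frob_vecMulVec,
    Matrix.trace_vecMulVec, dotProduct_comm c a]
  linear_combination (a ⬝ᵥ c) ^ 2 * h0

/-- The energy of a weighted laminate of rank-one strains is at most `μ₁` times its weighted
square. -/
theorem frob_mul_matrixTensor_le {μ₁ μ₂ lam : ℝ} (hL : Admissible (matrixTensor n μ₁ μ₂ lam))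
    (h0 : μ₂ + lam = 0) {Q : Mat n} (hQ : Q.PosSemidef) (htr : Q.trace = 1) (R : Mat n) :
    frob (R * Q) (matrixTensor n μ₁ μ₂ lam (R * Q)) ≤ μ₁ * frob R (R * Q) := by
  obtain ⟨C, hC⟩ := exists_eq_transpose_mul_self hQ
  set L := matrixTensor n μ₁ μ₂ lam
  set F : Fin n → Mat n := fun k => Matrix.vecMulVec (R.mulVec (C k)) (C k)
  have hF : R * Q = ∑ k, F k := by
    ext p i
    rw [hC, ← Matrix.mul_assoc, Matrix.sum_apply, Matrix.mul_apply]
    refine Finset.sum_congr rfl fun k _ => ?_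
    simp [F, Matrix.vecMulVec_apply, Matrix.mul_apply, Matrix.mulVec, dotProduct]
  have hw : ∑ k, C k ⬝ᵥ C k = 1 := by
    rw [← htr, hC, Matrix.trace_mul_comm]
    rfl
  have hR : frob R (R * Q) = ∑ k, R.mulVec (C k) ⬝ᵥ R.mulVec (C k) := by
    rw [hC, ← Matrix.mul_assoc, frob_mul_right, frob, Finset.sum_comm]
    simp [Matrix.mul_apply, Matrix.mulVec, dotProduct]
  -- With weight `w = |c_k|²`, expand the nonnegative energy of `F k - w R Q` and divide by `w`; a
  -- zero weight makes `F k` vanish and is treated apart. Summing over `k`, with total weight 1,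
  -- gives the claim.
  have key : ∀ k, 2 * frob (F k) (L (R * Q)) ≤
      (C k ⬝ᵥ C k) * frob (R * Q) (L (R * Q)) + μ₁ * (R.mulVec (C k) ⬝ᵥ R.mulVec (C k)) := by
    intro k
    have hFk : frob (F k) (L (F k)) =
      μ₁ * ((R.mulVec (C k) ⬝ᵥ R.mulVec (C k)) * (C k ⬝ᵥ C k)) :=
      frob_matrixTensor_vecMulVec h0 _ _
    have hnn : 0 ≤ C k ⬝ᵥ C k := Finset.sum_nonneg fun _ _ => mul_self_nonneg _
    rcases hnn.eq_or_lt with hz | hpos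
    · have hCk : C k = 0 := dotProduct_self_eq_zero.mp hz.symm
      simp [F, hCk, frob]
    · have hq := hL.frob_nonneg (F k - (C k ⬝ᵥ C k) • (R * Q))
      rw [map_sub, map_smul, frob_sub_left, frob_sub_right, frob_sub_right, frob_smul_left,
        frob_smul_left, frob_smul_right, frob_smul_right, hFk,
        hL.1 (R * Q) (F k), frob_comm (L (R * Q)) (F k)] at hq
      have : 0 ≤ (C k ⬝ᵥ C k) * ((C k ⬝ᵥ C k) * frob (R * Q) (L (R * Q)) +
          μ₁ * (R.mulVec (C k) ⬝ᵥ R.mulVec (C k)) - 2 * frob (F k) (L (R * Q))) := by linarith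
      linarith [nonneg_of_mul_nonneg_right this hpos]
  have hsum := Finset.sum_le_sum fun k (_ : k ∈ Finset.univ) => key k
  rw [Finset.sum_add_distrib, ← Finset.mul_sum, ← Finset.mul_sum, ← Finset.sum_mul, hw, ← hR,
    ← frob_sum_left, ← hF] at hsum
  linarith

/-- The tensor `R ↦ μ₁ R - c ΔL (R X)`. -/
noncomputable def reducedTensor (ΔL : Tensor n) (μ₁ c : ℝ) (X : Mat n) : Tensor n :=
  μ₁ • 1 - c • (ΔL * LinearMap.mulRight ℝ X)

lemma reducedTensor_apply (ΔL : Tensor n) (μ₁ c : ℝ) (X R : Mat n) :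
    reducedTensor ΔL μ₁ c X R = μ₁ • R - c • ΔL (R * X) := rfl

/-- The tensor `F ↦ M⁻¹(F) X` with `M` the reduced tensor; it is the inverse of
`-c ΔL + μ₁ (· X⁻¹)` when `X` is invertible. -/
noncomputable def reducedInverse (ΔL : Tensor n) (μ₁ c : ℝ) (X : Mat n) : Tensor n :=
  LinearMap.mulRight ℝ X * Ring.inverse (reducedTensor ΔL μ₁ c X)

lemma reducedInverse_apply (ΔL : Tensor n) (μ₁ c : ℝ) (X F : Mat n) :
    reducedInverse ΔL μ₁ c X F = Ring.inverse (reducedTensor ΔL μ₁ c X) F * X := rfl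

lemma reducedTensor_inverse_apply {ΔL : Tensor n} {μ₁ c : ℝ} {X : Mat n}
    (h : IsUnit (reducedTensor ΔL μ₁ c X)) (F : Mat n) :
    reducedTensor ΔL μ₁ c X (Ring.inverse (reducedTensor ΔL μ₁ c X) F) = F := by
  rw [← Module.End.mul_apply, Ring.mul_inverse_cancel _ h, Module.End.one_apply]

/-- If `M R = 0`, pairing with `R Q` gives `μ₁ R · RQ = (1 - θ) RQ · (L₀ - L₁)(RQ)`. This is at most
`(1 - θ) μ₁ R · RQ`, since `L₁` is semidefinite. As `θ μ₁ > 0`, `R · RQ = 0`; hence `R Q = 0`, and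
then `M R = μ₁ R` forces `R = 0`. -/
theorem isUnit_reducedTensor {μ₁ μ₂ lam θ : ℝ} {L₁ : Tensor n}
    (hL₀ : Admissible (matrixTensor n μ₁ μ₂ lam)) (hL₁ : Admissible L₁) (h0 : μ₂ + lam = 0)
    (hμ : 0 < μ₁) (hθ : 0 < θ) (hθ' : θ < 1)
    {Q : Mat n} (hQ : Q.PosSemidef) (htr : Q.trace = 1) :
    IsUnit (reducedTensor (matrixTensor n μ₁ μ₂ lam - L₁) μ₁ (1 - θ) Q) := by
  rw [LinearMap.isUnit_iff_ker_eq_bot, LinearMap.ker_eq_bot']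
  intro R hR
  rw [reducedTensor_apply, sub_eq_zero] at hR
  obtain ⟨C, hC⟩ := exists_eq_transpose_mul_self hQ
  have hnn : frob R (R * Q) = frob (R * C.transpose) (R * C.transpose) := by
    rw [hC, ← Matrix.mul_assoc, frob_mul_right]
  have hle := frob_mul_matrixTensor_le hL₀ h0 hQ htr R
  have h1 := hL₁.frob_nonneg (R * Q)
  have heq := congrArg (frob (R * Q)) hR
  rw [frob_smul_right, frob_smul_right, LinearMap.sub_apply, frob_sub_right, frob_comm (R * Q) R]
    at heq
  have hRQ0 : frob R (R * Q) = 0 := by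
    have hge : 0 ≤ frob R (R * Q) := hnn ▸ frob_self_nonneg _
    have : θ * μ₁ * frob R (R * Q) ≤ 0 := by
      have e1 := mul_le_mul_of_nonneg_left hle (sub_nonneg.mpr hθ'.le)
      have e2 := mul_nonneg (sub_nonneg.mpr hθ'.le) h1
      linarith
    exact le_antisymm (nonpos_of_mul_nonpos_right this (by positivity)) hge
  have hz : R * Q = 0 := by
    rw [hC, ← Matrix.mul_assoc, frob_self_eq_zero (hnn.symm.trans hRQ0), Matrix.zero_mul]
  rw [hz, map_zero, smul_zero] at hR
  exact (smul_eq_zero.mp hR).resolve_left hμ.ne'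

/-- Writing `F = M R` and `G = M S`, both pairings equal `μ₁ R · SX - c RX · ΔL (SX)`. -/
lemma isSymmTensor_reducedInverse {ΔL : Tensor n} {μ₁ c : ℝ} {X : Mat n}
    (h : IsUnit (reducedTensor ΔL μ₁ c X)) (hΔ : IsSymmTensor ΔL) (hX : X.IsSymm) :
    IsSymmTensor (reducedInverse ΔL μ₁ c X) := by
  intro F G
  have hF := reducedTensor_inverse_apply h F
  have hG := reducedTensor_inverse_apply h G
  rw [reducedInverse_apply, reducedInverse_apply]
  set R := Ring.inverse (reducedTensor ΔL μ₁ c X) F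
  set S := Ring.inverse (reducedTensor ΔL μ₁ c X) G
  rw [← hF, ← hG, reducedTensor_apply, reducedTensor_apply, frob_sub_left, frob_sub_right,
    frob_smul_left, frob_smul_left, frob_smul_right, frob_smul_right, hΔ, frob_comm (R * X) S,
    frob_mul_right S R X, hX.eq, frob_comm (S * X) R]

/-- The tensor `θ L₀ + (1 - θ) L₁ + Y(X)` in terms of the reduced tensor. -/
lemma smul_add_yTensor_eq (L₀ L₁ : Tensor n) (μ₁ θ : ℝ) {X : Mat n} (hX : IsUnit X)
    (hs : X.IsSymm) :
    θ • L₀ + (1 - θ) • L₁ + yTensor L₀ μ₁ X =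
      reducedTensor (L₀ - L₁) μ₁ (1 - θ) X * LinearMap.mulRight ℝ X⁻¹ := by
  have hdet := (Matrix.isUnit_iff_isUnit_det X).mp hX
  ext1 F
  -- Contraction over the second index is right multiplication by the transpose of `X⁻¹`, hence the
  -- need for symmetry of `X`.
  have hY : ofComponents (fun p i q j => μ₁ * δ p q * X⁻¹ i j) F = μ₁ • (F * X⁻¹) := by
    have hs' : X⁻¹.IsSymm := by
      rw [Matrix.IsSymm, Matrix.transpose_nonsing_inv, hs.eq]
    ext p i
    simp only [ofComponents, LinearMap.coe_mk, AddHom.coe_mk, Matrix.of_apply, Matrix.smul_apply,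
      Matrix.mul_apply, δ, smul_eq_mul]
    rw [Finset.sum_eq_single p (fun b _ hb => by simp [Ne.symm hb]) (by simp), Finset.mul_sum]
    refine Finset.sum_congr rfl fun j _ => ?_
    rw [hs'.apply j i]
    simp
    ring
  simp only [yTensor, LinearMap.add_apply, LinearMap.smul_apply, LinearMap.neg_apply, hY,
    Module.End.mul_apply, LinearMap.mulRight_apply, reducedTensor_apply, LinearMap.sub_apply,
    Matrix.nonsing_inv_mul_cancel_right _ _ hdet]
  module

lemma isUnit_mulRight_inv {X : Mat n} (hX : IsUnit X) :
    IsUnit (LinearMap.mulRight ℝ X⁻¹ : Tensor n) := by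
  have hdet := (Matrix.isUnit_iff_isUnit_det X).mp hX
  refine ⟨⟨LinearMap.mulRight ℝ X⁻¹, LinearMap.mulRight ℝ X, ?_, ?_⟩, rfl⟩ <;> ext1 F <;>
    simp [Matrix.mul_assoc, Matrix.mul_nonsing_inv _ hdet, Matrix.nonsing_inv_mul _ hdet]

lemma isUnit_smul_add_yTensor {L₀ L₁ : Tensor n} {μ₁ θ : ℝ} {X : Mat n} (hX : IsUnit X)
    (hs : X.IsSymm) (h : IsUnit (reducedTensor (L₀ - L₁) μ₁ (1 - θ) X)) :
    IsUnit (θ • L₀ + (1 - θ) • L₁ + yTensor L₀ μ₁ X) := by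
  rw [smul_add_yTensor_eq L₀ L₁ μ₁ θ hX hs]
  exact h.mul (isUnit_mulRight_inv hX)

/-- The right-hand side no longer contains `X⁻¹`; this is what identifies the limit when `X` tends
to a singular matrix. -/
lemma inverse_smul_add_yTensor {L₀ L₁ : Tensor n} {μ₁ θ : ℝ} {X : Mat n} (hX : IsUnit X)
    (hs : X.IsSymm) (h : IsUnit (reducedTensor (L₀ - L₁) μ₁ (1 - θ) X)) :
    Ring.inverse (θ • L₀ + (1 - θ) • L₁ + yTensor L₀ μ₁ X) =
      reducedInverse (L₀ - L₁) μ₁ (1 - θ) X := by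
  have hdet := (Matrix.isUnit_iff_isUnit_det X).mp hX
  have hT := isUnit_smul_add_yTensor hX hs h
  have hTK : (θ • L₀ + (1 - θ) • L₁ + yTensor L₀ μ₁ X) *
      reducedInverse (L₀ - L₁) μ₁ (1 - θ) X = 1 := by
    rw [smul_add_yTensor_eq L₀ L₁ μ₁ θ hX hs]
    ext1 F
    rw [Module.End.mul_apply, Module.End.mul_apply, reducedInverse_apply,
      LinearMap.mulRight_apply, Matrix.mul_nonsing_inv_cancel_right _ _ hdet,
      reducedTensor_inverse_apply h, Module.End.one_apply]
  calc _ = Ring.inverse (θ • L₀ + (1 - θ) • L₁ + yTensor L₀ μ₁ X) *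
        ((θ • L₀ + (1 - θ) • L₁ + yTensor L₀ μ₁ X) *
          reducedInverse (L₀ - L₁) μ₁ (1 - θ) X) := by rw [hTK, mul_one]
    _ = _ := by rw [← mul_assoc, Ring.inverse_mul_cancel _ hT, one_mul]

/-! ### The regularisation `Q + ε I` and the effective tensor -/

/-- Invertibility is stable, and inversion continuous, along lines of tensors. -/
theorem eventually_isUnit_and_tendsto_inverse {A : Tensor n} (hA : IsUnit A) (B : Tensor n) :
    (∀ᶠ ε : ℝ in 𝓝 0, IsUnit (A + ε • B)) ∧
      ∀ F, Tendsto (fun ε : ℝ => Ring.inverse (A + ε • B) F) (𝓝 0) (𝓝 (Ring.inverse A F)) := by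
  -- In coordinates invertibility is the open condition `det ≠ 0`, and the inverse is the adjugate
  -- over the determinant, which is continuous there.
  let φ : Tensor n ≃ₐ[ℝ] Matrix (Fin n × Fin n) (Fin n × Fin n) ℝ :=
    LinearMap.toMatrixAlgEquiv (Matrix.stdBasis ℝ (Fin n) (Fin n))
  have hunit : ∀ T : Tensor n, IsUnit T ↔ (φ T).det ≠ 0 := fun T => by
    rw [← isUnit_iff_ne_zero, ← Matrix.isUnit_iff_isUnit_det]
    exact (MulEquiv.isUnit_map φ).symm
  have hinv : ∀ T : Tensor n, IsUnit T → Ring.inverse T = φ.symm (φ T)⁻¹ := fun T hT => by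
    have hdet : IsUnit (φ T).det := isUnit_iff_ne_zero.mpr ((hunit T).mp hT)
    have h1 : T * φ.symm (φ T)⁻¹ = 1 := by
      apply φ.injective
      rw [map_mul, φ.apply_symm_apply, Matrix.mul_nonsing_inv _ hdet, map_one]
    calc Ring.inverse T = Ring.inverse T * (T * φ.symm (φ T)⁻¹) := by rw [h1, mul_one]
      _ = _ := by rw [← mul_assoc, Ring.inverse_mul_cancel _ hT, one_mul]
  have hcont : Continuous fun ε : ℝ => φ (A + ε • B) := by
    simp only [map_add, map_smul]
    fun_prop
  have hdetc : Continuous fun ε : ℝ => (φ (A + ε • B)).det := hcont.matrix_det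
  have hA0 : (φ (A + (0 : ℝ) • B)).det ≠ 0 := by
    rw [zero_smul, add_zero]
    exact (hunit A).mp hA
  have hev : ∀ᶠ ε : ℝ in 𝓝 0, IsUnit (A + ε • B) := by
    filter_upwards [hdetc.continuousAt.eventually_ne hA0] with ε hε
    exact (hunit _).mpr hε
  refine ⟨hev, fun F => ?_⟩
  have hlim : Tendsto (fun ε : ℝ => (φ (A + ε • B))⁻¹) (𝓝 0) (𝓝 (φ A)⁻¹) := by
    have h1 : ContinuousAt (fun ε : ℝ => ((φ (A + ε • B)).det)⁻¹ • (φ (A + ε • B)).adjugate) 0 :=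
      (hdetc.continuousAt.inv₀ hA0).smul hcont.matrix_adjugate.continuousAt
    have h2 := h1.tendsto
    simpa only [Matrix.inv_def, Ring.inverse_eq_inv', zero_smul, add_zero] using h2
  have hev2 : Continuous fun S : Matrix (Fin n × Fin n) (Fin n × Fin n) ℝ => φ.symm S F :=
    LinearMap.continuous_of_finiteDimensional
      ((LinearMap.applyₗ F : Tensor n →ₗ[ℝ] Mat n) ∘ₗ φ.symm.toLinearMap)
  have h3 := (hev2.tendsto (φ A)⁻¹).comp hlim
  rw [hinv A hA]
  refine h3.congr' ?_
  filter_upwards [hev] with ε hε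
  rw [hinv _ hε]
  rfl

/-- The reduced tensor is affine in `X`, so regularising `Q` moves it along a line and `ε = 0` is a
regular point. -/
lemma reducedTensor_add_smul_one (ΔL : Tensor n) (μ₁ c : ℝ) (X : Mat n) (ε : ℝ) :
    reducedTensor ΔL μ₁ c (X + ε • (1 : Mat n)) = reducedTensor ΔL μ₁ c X + ε • (-(c • ΔL)) := by
  ext1 R
  simp only [reducedTensor_apply, LinearMap.add_apply, LinearMap.smul_apply, LinearMap.neg_apply,
    mul_add, Matrix.mul_smul, mul_one, map_add, map_smul]
  module

/-- The effective tensor of an E-inclusion when `μ₂ + lam = 0`. -/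
theorem IsPeriodicEInclusion.isEffectiveTensor {e : Module.Basis (Fin n) ℝ (Space n)}
    {μ₁ μ₂ lam θ : ℝ} {L₁ : Tensor n} {Ω : Set (Space n)} {Q : Mat n}
    (hL₀ : Admissible (matrixTensor n μ₁ μ₂ lam))
    (hL₁ : Admissible L₁) (h : IsPeriodicEInclusion e Ω Q) (hQ : Q.IsSymm)
    (hθ : θ = volumeFraction e Ω)
    (hcell : volume.real (unitCell e) ≠ 0) (h0 : μ₂ + lam = 0)
    (hM : IsUnit (reducedTensor (matrixTensor n μ₁ μ₂ lam - L₁) μ₁ (1 - θ) Q)) :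
    IsEffectiveTensor e (matrixTensor n μ₁ μ₂ lam) L₁ Ω
      (θ • L₁ + (1 - θ) • matrixTensor n μ₁ μ₂ lam - (θ * (1 - θ)) •
        ((matrixTensor n μ₁ μ₂ lam - L₁) *
          reducedInverse (matrixTensor n μ₁ μ₂ lam - L₁) μ₁ (1 - θ) Q *
          (matrixTensor n μ₁ μ₂ lam - L₁))) := by
  set L₀ := matrixTensor n μ₁ μ₂ lam with hL₀def
  have hΔ : IsSymmTensor (L₀ - L₁) := fun F G => by
    rw [LinearMap.sub_apply, LinearMap.sub_apply, frob_sub_left, frob_sub_right, hL₀.1, hL₁.1]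
  refine ⟨fun F G => ?_, fun F => ?_⟩
  · have hK := isSymmTensor_reducedInverse hM hΔ hQ
    simp only [LinearMap.sub_apply (θ • L₁ + _), LinearMap.add_apply, LinearMap.smul_apply,
      Module.End.mul_apply, frob_sub_left, frob_sub_right, frob_add_left, frob_add_right,
      frob_smul_left, frob_smul_right]
    rw [hL₀.1, hL₁.1, hΔ, hK, hΔ]
  · have hR := reducedTensor_inverse_apply hM ((L₀ - L₁) F)
    have hKF := reducedInverse_apply (L₀ - L₁) μ₁ (1 - θ) Q ((L₀ - L₁) F)
    set R := Ring.inverse (reducedTensor (L₀ - L₁) μ₁ (1 - θ) Q) ((L₀ - L₁) F)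
    rw [reducedTensor_apply] at hR
    -- With `B = -R` the matching condition is the equation `M R = ΔL F` solved by `R`.
    have hmain := h.isLeast_energyValues_of_add_eq_zero hL₀ hL₁ hcell h0 (F := F) (B := -R) (by
      rw [← hθ, ← hL₀def, neg_mul, smul_neg, sub_neg_eq_add, map_add, map_smul, ← hR]
      module)
    -- The same equation eliminates `μ₁ R` from `L₀ F - θ μ₁ R`, leaving the stated formula.
    have hval : (θ • L₁ + (1 - θ) • L₀ - (θ * (1 - θ)) • ((L₀ - L₁) *
        reducedInverse (L₀ - L₁) μ₁ (1 - θ) Q * (L₀ - L₁))) F = L₀ F + θ • μ₁ • (-R) := by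
      have hμR : μ₁ • R = (L₀ - L₁) F + (1 - θ) • (L₀ - L₁) (R * Q) := by rw [← hR]; module
      rw [smul_neg, hμR, LinearMap.sub_apply, LinearMap.smul_apply, Module.End.mul_apply,
        Module.End.mul_apply, hKF]
      simp only [LinearMap.add_apply, LinearMap.smul_apply, LinearMap.sub_apply]
      module
    rw [hval, frob_add_right, frob_smul_right, hθ]
    exact hmain

end Composite

/-! ### Assembly of the two cases -/

open Composite
theorem mainTheorem4 {n : ℕ} (e : Module.Basis (Fin n) ℝ (Space n))
    (μ₁ μ₂ lam θ : ℝ) (L₀ L₁ ΔL : Tensor n) (Ω : Set (Space n)) (Q : Mat n)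
    (hL₀_eq : L₀ = matrixTensor n μ₁ μ₂ lam) (hL₀ : Admissible L₀) (hL₁ : Admissible L₁)
    (hΔL : ΔL = L₀ - L₁)
    (hQ : Q.PosSemidef) (hQ_trace : Q.trace = 1)
    (hΩ : IsPeriodicEInclusion e Ω Q)
    (hθ : θ = volumeFraction e Ω) (hθ_pos : 0 < θ) (hθ_lt : θ < 1) :
    (μ₂ + lam = 0 →
      (IsUnit Q →
        IsUnit (θ • L₀ + (1 - θ) • L₁ + yTensor L₀ μ₁ Q) ∧
        IsEffectiveTensor e L₀ L₁ Ω
          (θ • L₁ + (1 - θ) • L₀ - (θ * (1 - θ)) •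
            (ΔL * Ring.inverse (θ • L₀ + (1 - θ) • L₁ + yTensor L₀ μ₁ Q) * ΔL))) ∧
      (¬ IsUnit Q →
        (∀ᶠ ε : ℝ in 𝓝[>] 0,
          IsUnit (θ • L₀ + (1 - θ) • L₁ + yTensor L₀ μ₁ (Q + ε • (1 : Mat n)))) ∧
        ∃ K : Tensor n,
          (∀ F : Mat n, Tendsto
            (fun ε : ℝ => Ring.inverse
              (θ • L₀ + (1 - θ) • L₁ + yTensor L₀ μ₁ (Q + ε • (1 : Mat n))) F)
            (𝓝[>] 0) (𝓝 (K F))) ∧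
          IsEffectiveTensor e L₀ L₁ Ω
            (θ • L₁ + (1 - θ) • L₀ - (θ * (1 - θ)) • (ΔL * K * ΔL)))) ∧
    (μ₂ + lam ≠ 0 → ∀ A : Mat n, ΔL A = 1 →
      (1 - θ) - (μ₁ + μ₂ + lam) * A.trace ≠ 0 →
      ∀ F : Mat n, F.trace ≠ 0 →
        (1 / F.trace) • ΔL F =
          (1 / ((1 - θ) - (μ₁ + μ₂ + lam) * A.trace)) •
            ((1 - θ) • ΔL Q - (μ₁ + μ₂ + lam) • (1 : Mat n)) →
        IsLeast (energyValues e L₀ L₁ Ω F)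
          (1 / 2 * (frob F (L₀ F) +
            θ * (μ₁ + μ₂ + lam) / ((1 - θ) - (μ₁ + μ₂ + lam) * A.trace) * F.trace ^ 2)) ∧
        ∀ Le : Tensor n, IsEffectiveTensor e L₀ L₁ Ω Le →
          frob F (Le F) = frob F (L₀ F) +
            θ * (μ₁ + μ₂ + lam) / ((1 - θ) - (μ₁ + μ₂ + lam) * A.trace) * F.trace ^ 2) := by

  subst hΔL
  subst hL₀_eq
  -- Division by zero gives zero, so a cell of real volume zero would force `θ = 0`.
  have hcell : volume.real (unitCell e) ≠ 0 := fun hz => by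
    rw [hθ, volumeFraction, hz, div_zero] at hθ_pos
    exact hθ_pos.false
  have hQs : Q.IsSymm := by
    have := hQ.isHermitian
    rwa [Matrix.IsHermitian, Matrix.conjTranspose_eq_transpose_of_trivial] at this
  refine ⟨fun h0 => ?_, fun _ A hA hD F hF hF' => ?_⟩
  · have hμ : 0 < μ₁ := by
      -- In dimension zero the trace of `Q` would be 0, not 1.
      have hn : Nonempty (Fin n) := by
        by_contra hne
        rw [not_nonempty_iff] at hne
        simp [Matrix.trace] at hQ_trace
      have := hL₀.sum_moduli_pos hn.some
      linarith
    have hM := isUnit_reducedTensor hL₀ hL₁ h0 hμ hθ_pos hθ_lt hQ hQ_trace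
    have hEff := hΩ.isEffectiveTensor hL₀ hL₁ hQs hθ hcell h0 hM
    refine ⟨fun hU => ⟨isUnit_smul_add_yTensor hU hQs hM, ?_⟩, fun _ => ?_⟩
    · rw [inverse_smul_add_yTensor hU hQs hM]
      exact hEff
    · obtain ⟨hev, hlim⟩ := eventually_isUnit_and_tendsto_inverse hM
        (-((1 - θ) • (matrixTensor n μ₁ μ₂ lam - L₁)))
      simp only [← reducedTensor_add_smul_one] at hev hlim
      have hpos : ∀ ε : ℝ, 0 < ε → IsUnit (Q + ε • (1 : Mat n)) := fun ε hε =>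
        (Matrix.PosDef.posSemidef_add hQ (Matrix.PosDef.one.smul hε)).isUnit
      have hsymm : ∀ ε : ℝ, (Q + ε • (1 : Mat n)).IsSymm := fun ε =>
        hQs.add (Matrix.isSymm_one.smul ε)
      have hev' := hev.filter_mono (nhdsWithin_le_nhds (s := Set.Ioi (0 : ℝ)))
      -- The limit is the reduced inverse at the singular `Q` itself, so the effective tensor is
      -- already known.
      refine ⟨?_, reducedInverse (matrixTensor n μ₁ μ₂ lam - L₁) μ₁ (1 - θ) Q, fun F => ?_, hEff⟩
      · filter_upwards [hev', self_mem_nhdsWithin] with ε hε hε0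
        exact isUnit_smul_add_yTensor (hpos ε hε0) (hsymm ε) hε
      · have h1 := (hlim F).mono_left (nhdsWithin_le_nhds (s := Set.Ioi (0 : ℝ)))
        have h2 : Tendsto (fun ε : ℝ => Q + ε • (1 : Mat n)) (𝓝[>] 0) (𝓝 Q) := by
          have : Continuous fun ε : ℝ => Q + ε • (1 : Mat n) := by fun_prop
          have := (this.tendsto 0).mono_left (nhdsWithin_le_nhds (s := Set.Ioi (0 : ℝ)))
          simpa using this
        rw [reducedInverse_apply]
        refine (h1.mul h2).congr' ?_
        filter_upwards [hev', self_mem_nhdsWithin] with ε hε hε0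
        rw [inverse_smul_add_yTensor (hpos ε hε0) (hsymm ε) hε, reducedInverse_apply]
  · set m := μ₁ + μ₂ + lam with hm
    set D := (1 - θ) - m * A.trace with hDdef
    have hleast : IsLeast (energyValues e (matrixTensor n μ₁ μ₂ lam) L₁ Ω F)
        (1 / 2 * (frob F (matrixTensor n μ₁ μ₂ lam F) + θ * m / D * F.trace ^ 2)) := by
      have hΔF : (matrixTensor n μ₁ μ₂ lam - L₁) F = (F.trace / D) •
          ((1 - θ) • (matrixTensor n μ₁ μ₂ lam - L₁) Q - m • (1 : Mat n)) := by
        have := congrArg (fun Z => F.trace • Z) hF'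
        simp only [smul_smul, mul_one_div, div_self hF, one_smul] at this
        exact this
      -- With `b = F.trace / D` the hypothesis on `F` is the matching condition, and `θ b m Tr F` is
      -- the energy correction.
      have h1 := hΩ.isLeast_energyValues_of_scalar hL₀ hL₁ hcell (F := F) (b := F.trace / D) (by
        rw [map_sub, hΔF, map_smul, map_smul, ← hθ]
        module)
      convert h1 using 2
      rw [frob_smul_right, frob_one_right, ← hθ, ← hm]
      ring
    refine ⟨hleast, fun Le hLe => ?_⟩
    have := (hLe.2 F).unique hleast
    linarith
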